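/- Let $\mu \in \mathbb{R}$, $\sigma > 0$, $\beta > 0$ and $\lambda > 0$, and let $g : (0,\infty) \to [0,\infty)$ be convex. For each $x > 0$ let $(\Omega, \mathcal{F}, (\mathcal{F}_t)_{t \ge 0}, \mathbb{P}^x)$ be a filtered probability space satisfying the usual conditions (it may be a different one for each $x$) which carries an $(\mathcal{F}_t)$-Brownian motion $W$ and an independent $(\mathcal{F}_t)$-Poisson process $N$ of rate $\lambda$; relative to $(\mathcal{F}_t)$ means that both are adapted and that for each $s \ge 0$ the pair of increments $(W_{s+u} - W_s, N_{s+u} - N_s)_{u \ge 0}$ is independent of $\mathcal{F}_s$. Under $\mathbb{P}^x$ let $X$ be the exponential Brownian motion started at $x$, $$X_t = x \exp\left( \sigma W_t + (\mu - \tfrac{1}{2} \sigma^2) t \right), \qquad \text{that is,} \quad dX_t = \sigma X_t \, dW_t + \mu X_t \, dt, \quad X_0 = x.$$ Let $\mathbb{T}^\lambda$ be the (random) set of event times of $N$, let $T^\lambda_1$ be the first event time, and let $\mathcal{T}(\mathbb{T}^\lambda)$ be the set of $(\mathcal{F}_t)$-stopping times $\tau$ with $\tau \in \mathbb{T}^\lambda$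 almost surely. Then each of the functions $$x \mapsto \mathbb{E}^x[e^{-\beta t} g(X_t)] \ (\text{for each fixed } t \ge 0), \qquad G_\lambda(x) = \mathbb{E}^x[e^{-\beta T^\lambda_1} g(X_{T^\lambda_1})], \qquad V_\lambda(x) = \sup_{\tau \in \mathcal{T}(\mathbb{T}^\lambda)} \mathbb{E}^x[e^{-\beta \tau} g(X_\tau)]$$ is convex in $x \in (0,\infty)$, as a function with values in $[0,\infty]$; where the function is finite, this is ordinary convexity. -/

import Mathlib

open MeasureTheory ProbabilityTheory Set
open scoped NNReal ENNReal

/-- The usual conditions: the filtration is right-continuous and its initial σ-algebra contains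
every null set (hence, in particular, `P` is complete). -/
structure UsualConditions {Ω : Type*} {m : MeasurableSpace Ω} (F : Filtration ℝ≥0 m)
    (P : Measure Ω) : Prop where
  rightContinuous : F.IsRightContinuous
  complete : ∀ A : Set Ω, P A = 0 → MeasurableSet[F 0] A

/-- `N` is (the counting process of) a Poisson process of rate `lam`: it starts at zero, has
independent increments, the increment over `(s, t]` is Poisson with mean `lam * (t - s)`, and
almost every path is nondecreasing and right-continuous. -/
structure IsPoissonProcess {Ω : Type*} {m : MeasurableSpace Ω} (lam : ℝ≥0)
    (N : ℝ≥0 → Ω → ℕ) (P : Measure Ω) : Prop where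
  start : ∀ᵐ ω ∂P, N 0 ω = 0
  monotone : ∀ᵐ ω ∂P, Monotone fun t => N t ω
  rightCont : ∀ᵐ ω ∂P, ∀ t, ContinuousWithinAt (fun s => N s ω) (Ici t) t
  indepIncrements : HasIndepIncrements N P
  law : ∀ s t, s ≤ t →
    HasLaw (fun ω => N t ω - N s ω) (poissonMeasure (lam * (t - s))) P

/-- On the filtered probability space `(Ω, m, F, P)`, which satisfies the usual conditions, `W` is
a Brownian motion and `N` is an independent Poisson process of rate `lam`, both relative to `F`:
they are adapted, and for each `s` the increments after `s` are independent of `F s`. -/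
structure IsBrownianPoissonPair {Ω : Type*} {m : MeasurableSpace Ω} (F : Filtration ℝ≥0 m)
    (P : Measure Ω) (lam : ℝ≥0) (W : ℝ≥0 → Ω → ℝ) (N : ℝ≥0 → Ω → ℕ) : Prop where
  isProbability : IsProbabilityMeasure P
  usual : UsualConditions F P
  brownian : IsBrownianReal W P
  poisson : IsPoissonProcess lam N P
  indep : IndepFun (fun ω t => W t ω) (fun ω t => N t ω) P
  adaptedW : ∀ t, Measurable[F t] (W t)
  adaptedN : ∀ t, Measurable[F t] (N t)
  indepPast : ∀ s, Indep (F s)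
    (MeasurableSpace.comap
      (fun ω (u : ℝ≥0) => (W (s + u) ω - W s ω, N (s + u) ω - N s ω)) inferInstance) P

/-- Exponential Brownian motion with drift `μ` and volatility `σ`, started at `x` and driven by
the Brownian motion `W`, i.e. the solution of `dX = σ X dW + μ X dt`, `X 0 = x`. -/
noncomputable def expBM {Ω : Type*} (μ σ x : ℝ) (W : ℝ≥0 → Ω → ℝ) (t : ℝ≥0) (ω : Ω) : ℝ :=
  x * Real.exp (σ * W t ω + (μ - σ ^ 2 / 2) * (t : ℝ))

/-- The set of event times (jump times) of the counting process `N` on the outcome `ω`. -/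
def eventTimes {Ω : Type*} (N : ℝ≥0 → Ω → ℕ) (ω : Ω) : Set ℝ≥0 :=
  {t | 0 < t ∧ ∀ s < t, N s ω < N t ω}

/-- The first event time of `N`. -/
noncomputable def firstEventTime {Ω : Type*} (N : ℝ≥0 → Ω → ℕ) (ω : Ω) : ℝ≥0 :=
  sInf (eventTimes N ω)

/-- The expected discounted payoff `E[exp(-β τ) g(X_τ)]` for a nonnegative payoff `g`, as an
element of `[0, ∞]`. -/
noncomputable def expectedPayoff {Ω : Type*} {m : MeasurableSpace Ω} (P : Measure Ω)
    (X : ℝ≥0 → Ω → ℝ) (β : ℝ) (g : ℝ → ℝ) (τ : Ω → ℝ≥0) : ℝ≥0∞ :=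
  ∫⁻ ω, ENNReal.ofReal (Real.exp (-β * (τ ω : ℝ)) * g (X (τ ω) ω)) ∂P

/-- The (almost surely finite) stopping times of `F` which take values in the set of event times
of `N`. -/
def poissonStoppingTimes {Ω : Type*} {m : MeasurableSpace Ω} (F : Filtration ℝ≥0 m)
    (P : Measure Ω) (N : ℝ≥0 → Ω → ℕ) : Set (Ω → ℝ≥0) :=
  {τ | IsStoppingTime F (fun ω => (τ ω : WithTop ℝ≥0)) ∧ ∀ᵐ ω ∂P, τ ω ∈ eventTimes N ω}

/-- The value of the Poisson optimal stopping problem. -/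
noncomputable def poissonValue {Ω : Type*} {m : MeasurableSpace Ω} (F : Filtration ℝ≥0 m)
    (P : Measure Ω) (N : ℝ≥0 → Ω → ℕ) (X : ℝ≥0 → Ω → ℝ) (β : ℝ) (g : ℝ → ℝ) : ℝ≥0∞ :=
  ⨆ τ ∈ poissonStoppingTimes F P N, expectedPayoff P X β g τ

/-! The process started at `x` is `x` times a positive random factor whose law does not depend on
`x`. If `f` is convex on `(0, ∞)`, so is `x ↦ f (x * c)` for each `c > 0`, and so is any mixture of
such functions with nonnegative weights (`ConvexOn.lintegral_dilation`). This settles the fixed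
time, and also the first event time, once the pair `(T, W_T)` is known to have the law of `(T, √T
Z)` with `T` exponential and `Z` an independent standard normal. Hence the resolvent `R =
poissonResolvent` preserves convexity.

The value function is reached by value iteration: `v₀ = f` and `v_{n+1} = max f (R vₙ)`, where `f`
is the payoff. Maxima, suprema and `R` preserve convexity, so it suffices to prove `V = sup R vₙ`, a
formula in which the probability space no longer appears (`IsRegularPair.poissonValue_eq`).

For `≤`, the limit `u = sup vₙ` satisfies `f ≤ u` and, by monotone convergence, `R u ≤ u`. Such a
`u` is excessive along the event times, so it bounds every admissible stopping time
(`lintegral_discount_le`). For `≥`, the rule that stops at the first event where `f` is at least the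
continuation value, with a finite horizon, attains `R vₙ` (`lintegral_stoppingRule`).

Both inequalities rest on a strong Markov property between consecutive event times (`strongMarkov`).
It is proved by rounding times up to a mesh, applying the simple Markov property on each mesh cell,
letting the mesh tend to zero for bounded continuous functions, and extending to measurable
functions by comparing finite measures. To avoid null sets, all this is done for pairs with regular
paths; completeness of the filtration allows the given pair to be replaced by one of these
(`exists_isRegularPair`). -/

open Filter Topology

/-! ### Exponential waiting times and their discretisation. -/

/-- The exponential distribution of rate `lam`, as a measure on `ℝ≥0`. -/
noncomputable def waitingLaw (lam : ℝ≥0) : Measure ℝ≥0 := (expMeasure lam).map Real.toNNReal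

theorem isProbabilityMeasure_waitingLaw {lam : ℝ≥0} (hlam : 0 < lam) :
    IsProbabilityMeasure (waitingLaw lam) := by
  have := isProbabilityMeasure_expMeasure (r := (lam : ℝ)) (by exact_mod_cast hlam)
  exact Measure.isProbabilityMeasure_map measurable_real_toNNReal.aemeasurable

theorem waitingLaw_Iic {lam : ℝ≥0} (hlam : 0 < lam) (t : ℝ≥0) :
    waitingLaw lam (Iic t) = ENNReal.ofReal (1 - Real.exp (-(lam * t))) := by
  have hl : (0 : ℝ) < lam := by exact_mod_cast hlam
  have := isProbabilityMeasure_expMeasure hl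
  have h := cdf_expMeasure_eq hl (t : ℝ)
  rw [if_pos t.coe_nonneg, cdf_eq_real] at h
  rw [waitingLaw, Measure.map_apply measurable_real_toNNReal measurableSet_Iic]
  have hpre : Real.toNNReal ⁻¹' Iic t = Iic (t : ℝ) := by
    ext r; simp [Real.toNNReal_le_iff_le_coe]
  rw [hpre, ← h, ofReal_measureReal]

/-- A difference of two survival probabilities, the shape in which a Poisson process produces it: no
event up to `u`, minus no event up to `v`. -/
theorem waitingLaw_Ioc {lam : ℝ≥0} (hlam : 0 < lam) {u v : ℝ≥0} (huv : u ≤ v) :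
    waitingLaw lam (Ioc u v) =
      ENNReal.ofReal (Real.exp (-(lam * u))) - ENNReal.ofReal (Real.exp (-(lam * v))) := by
  have := isProbabilityMeasure_waitingLaw hlam
  rw [← Iic_sdiff_Iic, measure_sdiff (Iic_subset_Iic.2 huv) measurableSet_Iic.nullMeasurableSet
    (measure_ne_top _ _), waitingLaw_Iic hlam, waitingLaw_Iic hlam,
    ← ENNReal.ofReal_sub _ (Real.exp_pos _).le, ← ENNReal.ofReal_sub]
  · congr 1; ring
  · rw [sub_nonneg, Real.exp_le_one_iff, neg_nonpos]; positivity

theorem waitingLaw_zero {lam : ℝ≥0} (hlam : 0 < lam) : waitingLaw lam {0} = 0 := by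
  have h : ({0} : Set ℝ≥0) = Iic 0 := by ext; simp
  rw [h, waitingLaw_Iic hlam]; simp

/-- Rounding `t` up to the next multiple of `δ`. -/
noncomputable def meshCeil (δ t : ℝ≥0) : ℝ≥0 := (⌈t / δ⌉₊ : ℝ≥0) * δ

theorem le_meshCeil {δ : ℝ≥0} (hδ : 0 < δ) (t : ℝ≥0) : t ≤ meshCeil δ t := by
  rw [meshCeil, ← div_le_iff₀ hδ]; exact Nat.le_ceil _

theorem meshCeil_le_add {δ : ℝ≥0} (hδ : 0 < δ) (t : ℝ≥0) : meshCeil δ t ≤ t + δ := by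
  have h := (Nat.ceil_lt_add_one (a := t / δ) (zero_le)).le
  calc meshCeil δ t ≤ (t / δ + 1) * δ := by unfold meshCeil; gcongr
    _ = t + δ := by field_simp

theorem measurable_meshCeil (δ : ℝ≥0) : Measurable (meshCeil δ) := by
  unfold meshCeil
  have : Measurable fun t : ℝ≥0 => ((⌈t / δ⌉₊ : ℕ) : ℝ≥0) :=
    measurable_from_nat.comp (Nat.measurable_ceil.comp (measurable_id.div_const δ))
  exact this.mul_const δ

theorem tendsto_meshCeil (t : ℝ≥0) :
    Tendsto (fun m : ℕ => meshCeil (1 / ((m : ℝ≥0) + 1)) t) atTop (𝓝 t) := by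
  refine tendsto_of_tendsto_of_tendsto_of_le_of_le tendsto_const_nhds
    (h := fun m : ℕ => t + 1 / ((m : ℝ≥0) + 1)) ?_
    (fun m => le_meshCeil (by positivity) t) (fun m => meshCeil_le_add (by positivity) t)
  simpa using tendsto_const_nhds.add (tendsto_one_div_add_atTop_nhds_zero_nat (𝕜 := ℝ≥0))

theorem ceil_div_eq_succ_iff {δ : ℝ≥0} (hδ : 0 < δ) (t : ℝ≥0) (k : ℕ) :
    ⌈t / δ⌉₊ = k + 1 ↔ t ∈ Ioc ((k : ℝ≥0) * δ) (((k + 1 : ℕ) : ℝ≥0) * δ) := by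
  rw [Nat.ceil_eq_iff (by omega), Nat.add_sub_cancel, lt_div_iff₀ hδ, div_le_iff₀ hδ]; rfl

/-- The rounded time is constant on each mesh cell, and at a fixed time `s` the variable `√s Z` has
law `N(0, s)`. The resulting series is what the simple Markov property delivers cell by cell. -/
theorem lintegral_meshCeil {lam : ℝ≥0} (hlam : 0 < lam) {δ : ℝ≥0} (hδ : 0 < δ)
    {ψ : ℝ≥0 × ℝ → ℝ≥0∞} (hψ : Measurable ψ) :
    ∫⁻ p : ℝ≥0 × ℝ, ψ (meshCeil δ p.1, √(meshCeil δ p.1 : ℝ) * p.2)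
        ∂((waitingLaw lam).prod (gaussianReal 0 1)) =
      ∑' k : ℕ, waitingLaw lam (Ioc ((k : ℝ≥0) * δ) (((k + 1 : ℕ) : ℝ≥0) * δ)) *
        ∫⁻ w, ψ (((k + 1 : ℕ) : ℝ≥0) * δ, w) ∂(gaussianReal 0 (((k + 1 : ℕ) : ℝ≥0) * δ)) := by
  have := isProbabilityMeasure_waitingLaw hlam
  have hm := measurable_meshCeil δ
  set h : ℝ≥0 → ℝ≥0∞ := fun s => ∫⁻ w, ψ (s, √(s : ℝ) * w) ∂(gaussianReal 0 1) with hh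
  have hg : ∀ s : ℝ≥0, h s = ∫⁻ w, ψ (s, w) ∂(gaussianReal 0 s) := by
    intro s
    have := gaussianReal_map_const_mul (μ := 0) (v := 1) (√(s : ℝ))
    have e : gaussianReal 0 s = (gaussianReal 0 1).map (√(s : ℝ) * ·) := by
      rw [this]; congr 1
      · simp
      · ext; simp
    rw [e, lintegral_map (by fun_prop) (by fun_prop)]
  rw [lintegral_prod _ (by fun_prop)]
  change ∫⁻ r, h (meshCeil δ r) ∂(waitingLaw lam) = _
  -- The left-open cells miss only the point `0`, which is not an atom.
  have hae : (⋃ k : ℕ, Ioc ((k : ℝ≥0) * δ) (((k + 1 : ℕ) : ℝ≥0) * δ)) =ᵐ[waitingLaw lam] univ := by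
    have h0 : ∀ᵐ r ∂(waitingLaw lam), r ≠ 0 := by
      rw [ae_iff]; simpa using waitingLaw_zero hlam
    filter_upwards [h0] with r hr
    refine propext ⟨fun _ => trivial, fun _ => ?_⟩
    obtain ⟨k, hk⟩ := Nat.exists_eq_succ_of_ne_zero
      (Nat.ceil_pos.2 (div_pos (pos_iff_ne_zero.2 hr) hδ)).ne'
    exact mem_iUnion.2 ⟨k, (ceil_div_eq_succ_iff hδ r k).1 hk⟩
  rw [← setLIntegral_univ, ← setLIntegral_congr hae, lintegral_iUnion (fun _ => measurableSet_Ioc)]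
  · refine tsum_congr fun k => ?_
    rw [← hg, mul_comm (waitingLaw lam _), ← setLIntegral_const]
    refine setLIntegral_congr_fun measurableSet_Ioc fun r hr => ?_
    have := (ceil_div_eq_succ_iff hδ r k).2 hr
    simp only [meshCeil, this]
  · intro i j hij
    refine Set.disjoint_left.2 fun r hi hj => hij ?_
    have h1 := (ceil_div_eq_succ_iff hδ r i).2 hi
    have h2 := (ceil_div_eq_succ_iff hδ r j).2 hj
    omega

/-! ### Growth and discount factors, and the resolvent. -/

/-- The factor by which exponential Brownian motion has grown at time `s` when the driving
Brownian motion is at `w`. -/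
noncomputable def growth (μ σ : ℝ) (s : ℝ≥0) (w : ℝ) : ℝ :=
  Real.exp (σ * w + (μ - σ ^ 2 / 2) * (s : ℝ))

/-- The discount factor over a period of length `t`. -/
noncomputable def discount (β : ℝ) (t : ℝ≥0) : ℝ≥0∞ := ENNReal.ofReal (Real.exp (-β * (t : ℝ)))

theorem growth_add (μ σ : ℝ) (s t : ℝ≥0) (v w : ℝ) :
    growth μ σ (s + t) (v + w) = growth μ σ s v * growth μ σ t w := by
  simp only [growth, ← Real.exp_add]; congr 1; push_cast; ring

theorem growth_pos (μ σ : ℝ) (s : ℝ≥0) (w : ℝ) : 0 < growth μ σ s w := Real.exp_pos _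

@[fun_prop]
theorem continuous_discount (β : ℝ) : Continuous (discount β) :=
  ENNReal.continuous_ofReal.comp (by fun_prop)

@[fun_prop]
theorem measurable_discount (β : ℝ) : Measurable (discount β) := (continuous_discount β).measurable

theorem discount_add (β : ℝ) (s t : ℝ≥0) :
    discount β (s + t) = discount β s * discount β t := by
  rw [discount, discount, discount, ← ENNReal.ofReal_mul (Real.exp_pos _).le, ← Real.exp_add]
  congr 2; push_cast; ring

theorem discount_le_one {β : ℝ} (hβ : 0 ≤ β) (t : ℝ≥0) : discount β t ≤ 1 := by
  rw [discount, ENNReal.ofReal_le_one, Real.exp_le_one_iff]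
  have := mul_nonneg hβ t.coe_nonneg
  linarith

/-- The expected discounted value of `f` at exponential Brownian motion started at `x`, at an
independent exponential time of rate `lam`. -/
noncomputable def poissonResolvent (μ σ β : ℝ) (lam : ℝ≥0) (f : ℝ → ℝ≥0∞) (x : ℝ) : ℝ≥0∞ :=
  ∫⁻ p : ℝ≥0 × ℝ, discount β p.1 * f (x * growth μ σ p.1 (√(p.1 : ℝ) * p.2))
    ∂((waitingLaw lam).prod (gaussianReal 0 1))

theorem measurable_poissonResolvent (μ σ β : ℝ) {lam : ℝ≥0} (hlam : 0 < lam) {f : ℝ → ℝ≥0∞}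
    (hf : Measurable f) : Measurable (poissonResolvent μ σ β lam f) := by
  have := isProbabilityMeasure_waitingLaw hlam
  unfold poissonResolvent
  refine Measurable.lintegral_prod_right'
    (f := fun q : ℝ × (ℝ≥0 × ℝ) =>
      discount β q.2.1 * f (q.1 * growth μ σ q.2.1 (√(q.2.1 : ℝ) * q.2.2))) ?_
  unfold growth
  fun_prop

theorem poissonResolvent_mono (μ σ β : ℝ) (lam : ℝ≥0) {f f' : ℝ → ℝ≥0∞} (h : f ≤ f') :
    poissonResolvent μ σ β lam f ≤ poissonResolvent μ σ β lam f' := by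
  intro x
  unfold poissonResolvent
  gcongr
  exact h _

/-- Monotone convergence; it turns the recursion for `valueIter` into the inequality `R u ≤ u` for
the limit `u`. -/
theorem poissonResolvent_iSup (μ σ β : ℝ) (lam : ℝ≥0) {f : ℕ → ℝ → ℝ≥0∞}
    (hf : ∀ n, Measurable (f n))
    (hmono : Monotone f) (x : ℝ) :
    poissonResolvent μ σ β lam (fun y => ⨆ n, f n y) x = ⨆ n, poissonResolvent μ σ β lam (f n) x := by
  unfold poissonResolvent
  simp_rw [ENNReal.mul_iSup]
  rw [lintegral_iSup]
  · intro n
    have := hf n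
    unfold growth
    fun_prop
  · intro n k hnk p
    dsimp only
    gcongr
    exact hmono hnk _

/-! ### Convexity of functions with values in `[0, ∞]`. -/

theorem convexOn_nnreal_iff {f : ℝ → ℝ≥0∞} :
    ConvexOn ℝ≥0 (Ioi (0 : ℝ)) f ↔ ∀ x, 0 < x → ∀ y, 0 < y → ∀ a b : ℝ≥0, a + b = 1 →
      f (a * x + b * y) ≤ a * f x + b * f y := by
  constructor
  · intro h x hx y hy a b hab
    exact h.2 hx hy (zero_le) (zero_le) hab
  · intro h
    refine ⟨fun x hx y hy a b ha hb hab => ?_, fun x hx y hy a b ha hb hab => h x hx y hy a b hab⟩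
    have := (convex_Ioi (0 : ℝ)) hx hy a.coe_nonneg b.coe_nonneg
      (by rw [← NNReal.coe_add]; exact_mod_cast hab)
    exact this

theorem ConvexOn.iSup_ennreal {ι : Sort*} {f : ι → ℝ → ℝ≥0∞}
    (hf : ∀ i, ConvexOn ℝ≥0 (Ioi (0 : ℝ)) (f i)) :
    ConvexOn ℝ≥0 (Ioi (0 : ℝ)) fun x => ⨆ i, f i x := by
  refine convexOn_nnreal_iff.2 fun x hx y hy a b hab => iSup_le fun i => ?_
  refine (convexOn_nnreal_iff.1 (hf i) x hx y hy a b hab).trans ?_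
  gcongr
  · exact le_iSup (fun i => f i x) i
  · exact le_iSup (fun i => f i y) i

theorem ConvexOn.max_ennreal {f f' : ℝ → ℝ≥0∞} (hf : ConvexOn ℝ≥0 (Ioi (0 : ℝ)) f)
    (hf' : ConvexOn ℝ≥0 (Ioi (0 : ℝ)) f') :
    ConvexOn ℝ≥0 (Ioi (0 : ℝ)) fun x => max (f x) (f' x) := by
  refine convexOn_nnreal_iff.2 fun x hx y hy a b hab => max_le ?_ ?_
  · refine (convexOn_nnreal_iff.1 hf x hx y hy a b hab).trans ?_
    gcongr <;> exact le_max_left _ _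
  · refine (convexOn_nnreal_iff.1 hf' x hx y hy a b hab).trans ?_
    gcongr <;> exact le_max_right _ _

/-- Averages of a convex function along random dilations are convex. -/
theorem ConvexOn.lintegral_dilation {α : Type*} [MeasurableSpace α] (ν : Measure α)
    {f : ℝ → ℝ≥0∞} (hfm : Measurable f) (hf : ConvexOn ℝ≥0 (Ioi (0 : ℝ)) f)
    {d : α → ℝ≥0∞} (hd : Measurable d) {c : α → ℝ} (hc : Measurable c) (hpos : ∀ p, 0 < c p) :
    ConvexOn ℝ≥0 (Ioi (0 : ℝ)) fun x => ∫⁻ p, d p * f (x * c p) ∂ν := by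
  refine convexOn_nnreal_iff.2 fun x hx y hy a b hab => ?_
  rw [← lintegral_const_mul _ (by fun_prop), ← lintegral_const_mul _ (by fun_prop),
    ← lintegral_add_left (by fun_prop)]
  refine lintegral_mono fun p => ?_
  have := convexOn_nnreal_iff.1 hf (x * c p) (mul_pos hx (hpos p)) (y * c p)
    (mul_pos hy (hpos p)) a b hab
  calc d p * f ((a * x + b * y) * c p) = d p * f (a * (x * c p) + b * (y * c p)) := by
        congr 2; ring
    _ ≤ d p * (a * f (x * c p) + b * f (y * c p)) := by gcongr
    _ = _ := by ring

theorem ConvexOn.poissonResolvent (μ σ β : ℝ) (lam : ℝ≥0) {f : ℝ → ℝ≥0∞} (hfm : Measurable f)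
    (hf : ConvexOn ℝ≥0 (Ioi (0 : ℝ)) f) :
    ConvexOn ℝ≥0 (Ioi (0 : ℝ)) (poissonResolvent μ σ β lam f) :=
  ConvexOn.lintegral_dilation _ hfm hf
    (d := fun p : ℝ≥0 × ℝ => discount β p.1) (by fun_prop)
    (c := fun p : ℝ≥0 × ℝ => growth μ σ p.1 (√(p.1 : ℝ) * p.2)) (by unfold growth; fun_prop)
    fun _ => growth_pos _ _ _ _

/-! ### The payoff and its value iteration. -/

/-- A payoff on `(0, ∞)`, extended by zero and with values in `[0, ∞]`. -/
noncomputable def payoff (g : ℝ → ℝ) : ℝ → ℝ≥0∞ :=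
  (Ioi (0 : ℝ)).indicator fun x => ENNReal.ofReal (g x)

theorem payoff_of_pos (g : ℝ → ℝ) {x : ℝ} (hx : 0 < x) : payoff g x = ENNReal.ofReal (g x) :=
  indicator_of_mem (mem_Ioi.2 hx) _

/-- A convex function on an open interval is continuous there; cutting off outside `(0, ∞)` removes
the part of `g` about which nothing is known. -/
theorem measurable_payoff {g : ℝ → ℝ} (hg : ConvexOn ℝ (Ioi 0) g) : Measurable (payoff g) := by
  have hc : ContinuousOn (fun x => ENNReal.ofReal (g x)) (Ioi (0 : ℝ)) :=
    ENNReal.continuous_ofReal.comp_continuousOn (hg.continuousOn isOpen_Ioi)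
  have := hc.measurable_piecewise (g := fun _ => (0 : ℝ≥0∞)) continuousOn_const measurableSet_Ioi
  classical
  convert this using 1
  exact (piecewise_eq_indicator (s := Ioi (0 : ℝ))).symm

theorem convexOn_payoff {g : ℝ → ℝ} (hg_nonneg : ∀ x, 0 < x → 0 ≤ g x)
    (hg : ConvexOn ℝ (Ioi 0) g) : ConvexOn ℝ≥0 (Ioi (0 : ℝ)) (payoff g) := by
  refine convexOn_nnreal_iff.2 fun x hx y hy a b hab => ?_
  have hab' : (a : ℝ) + b = 1 := by exact_mod_cast hab
  have hxy : 0 < (a : ℝ) * x + b * y := (convex_Ioi (0 : ℝ)) hx hy a.coe_nonneg b.coe_nonneg hab'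
  have h := hg.2 hx hy a.coe_nonneg b.coe_nonneg hab'
  rw [payoff_of_pos g hx, payoff_of_pos g hy, payoff_of_pos g hxy]
  refine (ENNReal.ofReal_le_ofReal h).trans_eq ?_
  have e : ∀ c : ℝ≥0, (c : ℝ≥0∞) = ENNReal.ofReal c := fun c => by simp
  rw [e a, e b, ← ENNReal.ofReal_mul a.coe_nonneg, ← ENNReal.ofReal_mul b.coe_nonneg,
    ← ENNReal.ofReal_add]
  · rfl
  · exact mul_nonneg a.coe_nonneg (hg_nonneg x hx)
  · exact mul_nonneg b.coe_nonneg (hg_nonneg y hy)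

/-- The value of stopping at one of the first `n` event times or now. -/
noncomputable def valueIter (μ σ β : ℝ) (lam : ℝ≥0) (f : ℝ → ℝ≥0∞) : ℕ → ℝ → ℝ≥0∞
  | 0 => f
  | n + 1 => fun x => max (f x) (poissonResolvent μ σ β lam (valueIter μ σ β lam f n) x)

theorem measurable_valueIter (μ σ β : ℝ) {lam : ℝ≥0} (hlam : 0 < lam) {f : ℝ → ℝ≥0∞}
    (hf : Measurable f) (n : ℕ) : Measurable (valueIter μ σ β lam f n) := by
  induction n with
  | zero => exact hf
  | succ n ih => exact hf.max (measurable_poissonResolvent μ σ β hlam ih)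

theorem monotone_valueIter (μ σ β : ℝ) (lam : ℝ≥0) (f : ℝ → ℝ≥0∞) :
    Monotone (valueIter μ σ β lam f) := by
  refine monotone_nat_of_le_succ fun n => ?_
  induction n with
  | zero => exact fun x => le_max_left _ _
  | succ n ih => exact fun x => max_le_max le_rfl (poissonResolvent_mono μ σ β lam ih x)

theorem convexOn_valueIter (μ σ β : ℝ) {lam : ℝ≥0} (hlam : 0 < lam) {f : ℝ → ℝ≥0∞}
    (hfm : Measurable f) (hf : ConvexOn ℝ≥0 (Ioi (0 : ℝ)) f) (n : ℕ) :
    ConvexOn ℝ≥0 (Ioi (0 : ℝ)) (valueIter μ σ β lam f n) := by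
  induction n with
  | zero => exact hf
  | succ n ih =>
    exact hf.max_ennreal
      (ConvexOn.poissonResolvent μ σ β lam (measurable_valueIter μ σ β hlam hfm n) ih)

/-! ### Regular pairs, arrival times and their past. -/

/-- An adapted pair with the finite-dimensional Markov property of a Brownian motion and an
independent Poisson process, all of whose paths are regular. -/
structure IsRegularPair {Ω : Type*} {m : MeasurableSpace Ω} (F : Filtration ℝ≥0 m)
    (P : Measure Ω) (lam : ℝ≥0) (W : ℝ≥0 → Ω → ℝ) (N : ℝ≥0 → Ω → ℕ) : Prop where
  isProbability : IsProbabilityMeasure P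
  adaptedW : ∀ t, Measurable[F t] (W t)
  adaptedN : ∀ t, Measurable[F t] (N t)
  continuous : ∀ ω, Continuous fun t => W t ω
  W_zero : ∀ ω, W 0 ω = 0
  N_zero : ∀ ω, N 0 ω = 0
  monotone : ∀ ω, Monotone fun t => N t ω
  rightConst : ∀ ω t, ∃ s, t < s ∧ N s ω = N t ω
  surjective : ∀ ω n, ∃ t, N t ω = n
  markov : ∀ s u v : ℝ≥0, u ≤ v → ∀ B : Set Ω, MeasurableSet[F s] B → ∀ Y : Ω → ℝ,
    Measurable[F s] Y → ∀ φ : ℝ × ℝ → ℝ≥0∞, Measurable φ →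
    ∫⁻ ω in B ∩ {ω | N (s + u) ω = N s ω ∧ N s ω < N (s + v) ω},
        φ (Y ω, W (s + v) ω - W s ω) ∂P =
      waitingLaw lam (Ioc u v) * ∫⁻ ω in B, ∫⁻ w, φ (Y ω, w) ∂(gaussianReal 0 v) ∂P

/-- The time at which `N` reaches level `n`. -/
noncomputable def arrival {Ω : Type*} (N : ℝ≥0 → Ω → ℕ) (n : ℕ) (ω : Ω) : ℝ≥0 :=
  sInf {t | n ≤ N t ω}

/-- The event `A` belongs to the past of the random time `T`. -/
def IsPastEvent {Ω : Type*} {m : MeasurableSpace Ω} (F : Filtration ℝ≥0 m) (T : Ω → ℝ≥0)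
    (A : Set Ω) : Prop :=
  ∀ t, MeasurableSet[F t] (A ∩ {ω | T ω ≤ t})

namespace IsRegularPair

variable {Ω : Type*} {m : MeasurableSpace Ω} {F : Filtration ℝ≥0 m} {P : Measure Ω} {lam : ℝ≥0}
  {W : ℝ≥0 → Ω → ℝ} {N : ℝ≥0 → Ω → ℕ}

/-- The infimum is attained because paths stay constant for a while to the right of each time. -/
theorem arrival_le_iff (h : IsRegularPair F P lam W N) (n : ℕ) (ω : Ω) (t : ℝ≥0) :
    arrival N n ω ≤ t ↔ n ≤ N t ω := by
  refine ⟨fun hle => ?_, fun hle => csInf_le' hle⟩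
  by_contra! hlt
  obtain ⟨s, hts, hs⟩ := h.rightConst ω t
  have : s ≤ arrival N n ω := by
    obtain ⟨r, hr⟩ := h.surjective ω n
    refine le_csInf ⟨r, hr.ge⟩ fun r hr => ?_
    by_contra! hrs
    have := h.monotone ω hrs.le
    simp only [mem_ofPred_eq] at hr
    dsimp only at this
    omega
  exact (hts.trans_le this).not_ge hle

theorem lt_arrival_iff (h : IsRegularPair F P lam W N) (n : ℕ) (ω : Ω) (t : ℝ≥0) :
    t < arrival N n ω ↔ N t ω < n := by
  rw [← not_le, h.arrival_le_iff, not_le]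

theorem apply_arrival (h : IsRegularPair F P lam W N) (n : ℕ) (ω : Ω) :
    N (arrival N n ω) ω = n := by
  refine le_antisymm ?_ ((h.arrival_le_iff n ω _).1 le_rfl)
  obtain ⟨r, hr⟩ := h.surjective ω n
  exact (h.monotone ω ((h.arrival_le_iff n ω r).2 hr.ge)).trans hr.le

theorem arrival_lt (h : IsRegularPair F P lam W N) (n : ℕ) (ω : Ω) :
    arrival N n ω < arrival N (n + 1) ω := by
  rw [h.lt_arrival_iff, h.apply_arrival]; omega

theorem arrival_strictMono (h : IsRegularPair F P lam W N) (ω : Ω) :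
    StrictMono fun n => arrival N n ω :=
  strictMono_nat_of_lt_succ fun n => h.arrival_lt n ω

theorem arrival_zero (h : IsRegularPair F P lam W N) (ω : Ω) : arrival N 0 ω = 0 :=
  nonpos_iff_eq_zero.1 ((h.arrival_le_iff 0 ω 0).2 (Nat.zero_le _))

/-- Since every level is attained, all jumps have size one, so each event time is the arrival at the
level it reaches. -/
theorem mem_eventTimes_iff (h : IsRegularPair F P lam W N) (ω : Ω) (t : ℝ≥0) :
    t ∈ eventTimes N ω ↔ ∃ n, t = arrival N (n + 1) ω := by
  constructor
  · rintro ⟨h0, ht⟩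
    have h1 := ht 0 h0
    rw [h.N_zero] at h1
    obtain ⟨n, hn⟩ := Nat.exists_eq_succ_of_ne_zero h1.ne'
    refine ⟨n, le_antisymm ?_ ((h.arrival_le_iff _ ω t).2 hn.ge)⟩
    by_contra! hlt
    have := ht _ hlt
    rw [h.apply_arrival] at this
    omega
  · rintro ⟨n, rfl⟩
    refine ⟨(zero_le).trans_lt (h.arrival_lt n ω), fun s hs => ?_⟩
    rw [h.apply_arrival]
    exact (h.lt_arrival_iff _ ω s).1 hs

theorem firstEventTime_eq (h : IsRegularPair F P lam W N) (ω : Ω) :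
    firstEventTime N ω = arrival N 1 ω := by
  have hmem : arrival N 1 ω ∈ eventTimes N ω := (h.mem_eventTimes_iff ω _).2 ⟨0, rfl⟩
  refine le_antisymm (csInf_le' hmem) (le_csInf ⟨_, hmem⟩ fun t ht => ?_)
  obtain ⟨n, rfl⟩ := (h.mem_eventTimes_iff ω _).1 ht
  exact (h.arrival_strictMono ω).monotone (by omega)

theorem measurableSet_arrival_le (h : IsRegularPair F P lam W N) (n : ℕ) (t : ℝ≥0) :
    MeasurableSet[F t] {ω | arrival N n ω ≤ t} := by
  simp_rw [h.arrival_le_iff]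
  exact h.adaptedN t measurableSet_Ici

theorem isStoppingTime_arrival (h : IsRegularPair F P lam W N) (n : ℕ) :
    IsStoppingTime F fun ω => (arrival N n ω : WithTop ℝ≥0) := by
  intro t
  simp only [WithTop.coe_le_coe]
  exact h.measurableSet_arrival_le n t

@[fun_prop]
theorem measurable_arrival (h : IsRegularPair F P lam W N) (n : ℕ) : Measurable (arrival N n) :=
  measurable_of_Iic fun t => F.le t _ (h.measurableSet_arrival_le n t)

theorem measurable_W (h : IsRegularPair F P lam W N) {T : Ω → ℝ≥0} (hT : Measurable T) :
    Measurable fun ω => W (T ω) ω := by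
  have hu : Measurable (Function.uncurry W) :=
    measurable_uncurry_of_continuous_of_measurable h.continuous
      fun t => (h.adaptedW t).mono (F.le t) le_rfl
  exact hu.comp (hT.prodMk measurable_id)

theorem measurable_expBM (h : IsRegularPair F P lam W N) (μ σ x : ℝ) {T : Ω → ℝ≥0}
    (hT : Measurable T) : Measurable fun ω => expBM μ σ x W (T ω) ω := by
  have hW := h.measurable_W hT
  unfold expBM
  exact measurable_const.mul (((hW.const_mul σ).add (hT.coe_nnreal_real.const_mul _)).exp)

theorem continuous_expBM (h : IsRegularPair F P lam W N) (μ σ x : ℝ) (ω : Ω) :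
    Continuous fun t => expBM μ σ x W t ω := by
  have := h.continuous ω
  unfold expBM
  fun_prop

theorem expBM_zero (h : IsRegularPair F P lam W N) (μ σ x : ℝ) (ω : Ω) :
    expBM μ σ x W 0 ω = x := by
  simp [expBM, h.W_zero]

theorem measurableSet_of_isPastEvent {T : Ω → ℝ≥0} {A : Set Ω} (hA : IsPastEvent F T A) :
    MeasurableSet A := by
  have : A = ⋃ k : ℕ, A ∩ {ω | T ω ≤ k} := by
    rw [← inter_iUnion, eq_comm, inter_eq_left]
    exact fun ω _ => mem_iUnion.2 (exists_nat_ge (T ω))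
  rw [this]
  exact MeasurableSet.iUnion fun k => F.le _ _ (hA k)

theorem _root_.IsPastEvent.inter {T : Ω → ℝ≥0} {A B : Set Ω} (hA : IsPastEvent F T A)
    (hB : IsPastEvent F T B) : IsPastEvent F T (A ∩ B) := by
  intro t
  rw [inter_inter_distrib_right]
  exact (hA t).inter (hB t)

theorem _root_.IsPastEvent.sdiff {T : Ω → ℝ≥0} {A B : Set Ω} (hA : IsPastEvent F T A)
    (hB : IsPastEvent F T B) : IsPastEvent F T (A \ B) := by
  intro t
  rw [inter_sdiff_distrib_right]
  exact (hA t).diff (hB t)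

theorem isPastEvent_succ (h : IsRegularPair F P lam W N) {n : ℕ} {A : Set Ω}
    (hA : IsPastEvent F (arrival N n) A) : IsPastEvent F (arrival N (n + 1)) A := by
  intro t
  have : A ∩ {ω | arrival N (n + 1) ω ≤ t} =
      (A ∩ {ω | arrival N n ω ≤ t}) ∩ {ω | arrival N (n + 1) ω ≤ t} := by
    ext ω
    have := (h.arrival_lt n ω).le
    simp only [mem_inter_iff, mem_ofPred_eq]
    exact ⟨fun h => ⟨⟨h.1, this.trans h.2⟩, h.2⟩, fun h => ⟨h.1.1, h.2⟩⟩
  rw [this]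
  exact (hA t).inter (h.measurableSet_arrival_le _ t)

theorem isPastEvent_univ (h : IsRegularPair F P lam W N) (n : ℕ) :
    IsPastEvent F (arrival N n) univ := by
  intro t
  rw [univ_inter]
  exact h.measurableSet_arrival_le n t

/-- The rounded arrival equals `i * δ` when the arrival has occurred by `i * δ` but by no earlier
mesh point, which is decided at time `i * δ`. -/
theorem measurableSet_ceil_arrival (h : IsRegularPair F P lam W N) {δ : ℝ≥0} (hδ : 0 < δ)
    (n : ℕ) {A : Set Ω} (hA : IsPastEvent F (arrival N n) A) (i : ℕ) :
    MeasurableSet[F (i * δ)] (A ∩ {ω | ⌈arrival N n ω / δ⌉₊ = i}) := by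
  have key : A ∩ {ω | ⌈arrival N n ω / δ⌉₊ = i} = (A ∩ {ω | arrival N n ω ≤ i * δ}) ∩
      {ω | arrival N n ω ≤ i * δ ∧ ∀ k < i, ¬ arrival N n ω ≤ k * δ} := by
    ext ω
    simp only [mem_inter_iff, mem_ofPred_eq, ← div_le_iff₀ hδ, ← Nat.ceil_le]
    constructor
    · rintro ⟨hA, rfl⟩
      exact ⟨⟨hA, le_rfl⟩, le_rfl, fun k hk => by omega⟩
    · rintro ⟨⟨hA, h1⟩, -, h2⟩
      refine ⟨hA, le_antisymm h1 ?_⟩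
      by_contra! hlt
      exact h2 _ hlt le_rfl
  rw [key]
  refine (hA _).inter ((h.measurableSet_arrival_le n _).inter ?_)
  have : {ω | ∀ k < i, ¬ arrival N n ω ≤ k * δ} =
      ⋂ k : ℕ, ⋂ _ : k < i, {ω | arrival N n ω ≤ k * δ}ᶜ := by
    ext ω; simp
  change MeasurableSet[F (i * δ)] {ω | ∀ k < i, ¬ arrival N n ω ≤ k * δ}
  rw [this]
  refine MeasurableSet.iInter fun k => MeasurableSet.iInter fun hk => MeasurableSet.compl ?_
  refine F.mono ?_ _ (h.measurableSet_arrival_le n _)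
  gcongr

/-- Once the count at `i * δ` is `n`, the cell of the next arrival is read off from increments after
`i * δ`, the form to which the simple Markov property applies. -/
theorem meshCeil_arrival_mem_iff (h : IsRegularPair F P lam W N) {δ : ℝ≥0} (hδ : 0 < δ)
    (n i k : ℕ) (ω : Ω) :
    (N (i * δ) ω = n ∧ ⌈arrival N (n + 1) ω / δ⌉₊ = i + (k + 1)) ↔
      N (i * δ) ω = n ∧ (N (i * δ + k * δ) ω = N (i * δ) ω ∧
        N (i * δ) ω < N (i * δ + ((k + 1 : ℕ) : ℝ≥0) * δ) ω) := by
  rw [← add_assoc, ceil_div_eq_succ_iff hδ, mem_Ioc, h.lt_arrival_iff, h.arrival_le_iff,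
    ← add_mul, ← add_mul, ← Nat.cast_add, ← Nat.cast_add]
  have h1 : N (i * δ) ω ≤ N (((i + k : ℕ) : ℝ≥0) * δ) ω := h.monotone ω (by gcongr; omega)
  constructor
  · rintro ⟨ha, hb, hc⟩
    refine ⟨ha, by omega, ?_⟩
    rw [ha]; exact hc
  · rintro ⟨ha, hb, hc⟩
    refine ⟨ha, by omega, ?_⟩
    rw [ha] at hc; exact hc

end IsRegularPair

/-! ### The strong Markov property between consecutive event times. -/

namespace IsRegularPair

variable {Ω : Type*} {m : MeasurableSpace Ω} {F : Filtration ℝ≥0 m} {P : Measure Ω} {lam : ℝ≥0}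
  {W : ℝ≥0 → Ω → ℝ} {N : ℝ≥0 → Ω → ℕ}

/-- Rounding the `n`-th arrival up must not overtake the next one; this good event is visible at the
mesh point itself. -/
theorem meshCeil_arrival_lt_iff (h : IsRegularPair F P lam W N) {δ : ℝ≥0} (hδ : 0 < δ)
    (n i : ℕ) (ω : Ω) (hi : ⌈arrival N n ω / δ⌉₊ = i) :
    meshCeil δ (arrival N n ω) < arrival N (n + 1) ω ↔ N (i * δ) ω = n := by
  rw [h.lt_arrival_iff]
  have h1 : n ≤ N (meshCeil δ (arrival N n ω)) ω :=
    (h.arrival_le_iff n ω _).1 (le_meshCeil hδ _)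
  simp only [meshCeil, hi] at h1 ⊢
  omega

theorem markov_cell (h : IsRegularPair F P lam W N) (μ σ β x : ℝ) {δ : ℝ≥0} (i k : ℕ)
    {B : Set Ω} (hB : MeasurableSet[F (i * δ)] B)
    {f : ℝ → ℝ≥0∞} (hf : Measurable f) :
    ∫⁻ ω in B ∩ {ω | N (i * δ + k * δ) ω = N (i * δ) ω ∧
        N (i * δ) ω < N (i * δ + ((k + 1 : ℕ) : ℝ≥0) * δ) ω},
      discount β (i * δ + ((k + 1 : ℕ) : ℝ≥0) * δ) *
        f (expBM μ σ x W (i * δ + ((k + 1 : ℕ) : ℝ≥0) * δ) ω) ∂P =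
    waitingLaw lam (Ioc ((k : ℝ≥0) * δ) (((k + 1 : ℕ) : ℝ≥0) * δ)) *
      ∫⁻ ω in B, ∫⁻ w, discount β (i * δ + ((k + 1 : ℕ) : ℝ≥0) * δ) *
        f (expBM μ σ x W (i * δ) ω * growth μ σ (((k + 1 : ℕ) : ℝ≥0) * δ) w)
          ∂(gaussianReal 0 (((k + 1 : ℕ) : ℝ≥0) * δ)) ∂P := by
  have hY : Measurable[F (i * δ)] fun ω => expBM μ σ x W (i * δ) ω := by
    have hφ : Measurable fun w : ℝ =>
        x * Real.exp (σ * w + (μ - σ ^ 2 / 2) * ((i * δ : ℝ≥0) : ℝ)) := by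
      fun_prop
    exact hφ.comp (h.adaptedW _)
  have key := h.markov (i * δ) (k * δ) (((k + 1 : ℕ) : ℝ≥0) * δ)
    (by gcongr; omega) B hB _ hY
    (fun q => discount β (i * δ + ((k + 1 : ℕ) : ℝ≥0) * δ) *
      f (q.1 * growth μ σ (((k + 1 : ℕ) : ℝ≥0) * δ) q.2)) (by unfold growth; fun_prop)
  rw [← key]
  refine lintegral_congr fun ω => ?_
  congr 2
  have := growth_add μ σ (i * δ) (((k + 1 : ℕ) : ℝ≥0) * δ) (W (i * δ) ω)
    (W (i * δ + ((k + 1 : ℕ) : ℝ≥0) * δ) ω - W (i * δ) ω)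
  rw [add_sub_cancel] at this
  change x * growth μ σ _ _ = x * growth μ σ _ _ * _
  rw [this, mul_assoc]

/-- The strong Markov property between consecutive event times, with times rounded up to
multiples of `δ`. -/
theorem markov_meshCeil (h : IsRegularPair F P lam W N) (hlam : 0 < lam) (μ σ β x : ℝ)
    {δ : ℝ≥0} (hδ : 0 < δ) (n : ℕ) {A : Set Ω} (hA : IsPastEvent F (arrival N n) A)
    {f : ℝ → ℝ≥0∞} (hf : Measurable f) :
    ∫⁻ ω in A ∩ {ω | meshCeil δ (arrival N n ω) < arrival N (n + 1) ω},
      discount β (meshCeil δ (arrival N (n + 1) ω)) *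
        f (expBM μ σ x W (meshCeil δ (arrival N (n + 1) ω)) ω) ∂P =
    ∫⁻ ω in A ∩ {ω | meshCeil δ (arrival N n ω) < arrival N (n + 1) ω},
      ∫⁻ p : ℝ≥0 × ℝ, discount β (meshCeil δ (arrival N n ω) + meshCeil δ p.1) *
        f (expBM μ σ x W (meshCeil δ (arrival N n ω)) ω *
          growth μ σ (meshCeil δ p.1) (√(meshCeil δ p.1 : ℝ) * p.2))
        ∂((waitingLaw lam).prod (gaussianReal 0 1)) ∂P := by
  have := h.isProbability
  set S := {ω | meshCeil δ (arrival N n ω) < arrival N (n + 1) ω} with hS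
  -- `B i` is the part of the good event on which the `n`-th arrival rounds to `i * δ`; `C i k` puts
  -- the next arrival in the cell ending at `(i + k + 1) * δ`.
  set B : ℕ → Set Ω := fun i =>
    (A ∩ {ω | ⌈arrival N n ω / δ⌉₊ = i}) ∩ {ω | N (i * δ) ω = n} with hB
  set C : ℕ → ℕ → Set Ω := fun i k => {ω | N (i * δ + k * δ) ω = N (i * δ) ω ∧
        N (i * δ) ω < N (i * δ + ((k + 1 : ℕ) : ℝ≥0) * δ) ω} with hC
  have hBF : ∀ i : ℕ, MeasurableSet[F (i * δ)] (B i) := fun i =>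
    (h.measurableSet_ceil_arrival hδ n hA i).inter (h.adaptedN _ (measurableSet_singleton n))
  have hBm : ∀ i, MeasurableSet (B i) := fun i => F.le _ _ (hBF i)
  have hN : ∀ t, Measurable (N t) := fun t => (h.adaptedN t).mono (F.le t) le_rfl
  have hCm : ∀ i k, MeasurableSet (C i k) := fun i k =>
    (measurableSet_eq_fun (hN _) (hN _)).inter (measurableSet_lt (hN _) (hN _))
  have hAS : A ∩ S = ⋃ i, B i := by
    ext ω
    simp only [hS, hB, mem_inter_iff, mem_iUnion, mem_ofPred_eq]
    constructor
    · rintro ⟨hA, hlt⟩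
      exact ⟨_, ⟨hA, rfl⟩, (h.meshCeil_arrival_lt_iff hδ n _ ω rfl).1 hlt⟩
    · rintro ⟨i, ⟨hA, hi⟩, hn⟩
      exact ⟨hA, (h.meshCeil_arrival_lt_iff hδ n i ω hi).2 hn⟩
  have hdisjB : Pairwise (Function.onFun Disjoint B) := fun i j hij =>
    Set.disjoint_left.2 fun ω hi hj => hij (hi.1.2.symm.trans hj.1.2)
  have hcell : ∀ i k ω, ω ∈ B i ∩ C i k ↔
      ω ∈ B i ∧ ⌈arrival N (n + 1) ω / δ⌉₊ = i + (k + 1) := by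
    intro i k ω
    have := h.meshCeil_arrival_mem_iff hδ n i k ω
    simp only [hB, hC, mem_inter_iff, mem_ofPred_eq] at this ⊢
    tauto
  have hBC : ∀ i, B i = ⋃ k, B i ∩ C i k := by
    intro i
    refine Subset.antisymm (fun ω hω => mem_iUnion.2 ?_) (iUnion_subset fun k => inter_subset_left)
    have hlt := (h.meshCeil_arrival_lt_iff hδ n i ω hω.1.2).2 hω.2
    have hi : ⌈arrival N n ω / δ⌉₊ = i := hω.1.2
    simp only [meshCeil, hi] at hlt
    rw [← lt_div_iff₀ hδ, ← Nat.lt_ceil] at hlt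
    exact ⟨⌈arrival N (n + 1) ω / δ⌉₊ - i - 1, (hcell i _ ω).2 ⟨hω, by omega⟩⟩
  have hdisjC : ∀ i, Pairwise (Function.onFun Disjoint fun k => B i ∩ C i k) :=
    fun i k l hkl => Set.disjoint_left.2 fun ω hk hl => hkl (by
      have h1 := ((hcell i k ω).1 hk).2
      have h2 := ((hcell i l ω).1 hl).2
      omega)
  rw [hAS, lintegral_iUnion hBm hdisjB, lintegral_iUnion hBm hdisjB]
  refine tsum_congr fun i => ?_
  conv_lhs => rw [hBC i, lintegral_iUnion (fun k => (hBm i).inter (hCm i k)) (hdisjC i)]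
  have hmesh : ∀ k, ∀ ω ∈ B i ∩ C i k, meshCeil δ (arrival N (n + 1) ω) =
      i * δ + ((k + 1 : ℕ) : ℝ≥0) * δ := by
    intro k ω hω
    rw [meshCeil, ((hcell i k ω).1 hω).2]; push_cast; ring
  have hX : Measurable fun ω => expBM μ σ x W (i * δ) ω :=
    h.measurable_expBM μ σ x (T := fun _ => i * δ) measurable_const
  calc _ = ∑' k : ℕ, waitingLaw lam (Ioc ((k : ℝ≥0) * δ) (((k + 1 : ℕ) : ℝ≥0) * δ)) *
      ∫⁻ ω in B i, ∫⁻ w, discount β (i * δ + ((k + 1 : ℕ) : ℝ≥0) * δ) *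
        f (expBM μ σ x W (i * δ) ω * growth μ σ (((k + 1 : ℕ) : ℝ≥0) * δ) w)
          ∂(gaussianReal 0 (((k + 1 : ℕ) : ℝ≥0) * δ)) ∂P := by
        refine tsum_congr fun k => ?_
        rw [← h.markov_cell μ σ β x i k (hBF i) hf]
        refine setLIntegral_congr_fun ((hBm i).inter (hCm i k)) fun ω hω => ?_
        rw [hmesh k ω hω]
    _ = ∫⁻ ω in B i, ∑' k : ℕ, waitingLaw lam (Ioc ((k : ℝ≥0) * δ) (((k + 1 : ℕ) : ℝ≥0) * δ)) *
      ∫⁻ w, discount β (i * δ + ((k + 1 : ℕ) : ℝ≥0) * δ) *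
        f (expBM μ σ x W (i * δ) ω * growth μ σ (((k + 1 : ℕ) : ℝ≥0) * δ) w)
          ∂(gaussianReal 0 (((k + 1 : ℕ) : ℝ≥0) * δ)) ∂P := by
        have hin : ∀ k : ℕ, Measurable fun ω => ∫⁻ w,
            discount β (i * δ + ((k + 1 : ℕ) : ℝ≥0) * δ) *
            f (expBM μ σ x W (i * δ) ω * growth μ σ (((k + 1 : ℕ) : ℝ≥0) * δ) w)
              ∂(gaussianReal 0 (((k + 1 : ℕ) : ℝ≥0) * δ)) := by
          intro k
          refine Measurable.lintegral_prod_right' (f := fun q : Ω × ℝ =>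
            discount β (i * δ + ((k + 1 : ℕ) : ℝ≥0) * δ) *
            f (expBM μ σ x W (i * δ) q.1 * growth μ σ (((k + 1 : ℕ) : ℝ≥0) * δ) q.2)) ?_
          unfold growth
          fun_prop
        rw [lintegral_tsum fun k => ((hin k).const_mul _).aemeasurable]
        exact tsum_congr fun k => (lintegral_const_mul _ (hin k)).symm
    _ = _ := by
        refine setLIntegral_congr_fun (hBm i) fun ω hω => ?_
        have e : meshCeil δ (arrival N n ω) = i * δ := by rw [meshCeil, hω.1.2]
        rw [e, lintegral_meshCeil hlam hδ (ψ := fun q => discount β (i * δ + q.1) *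
          f (expBM μ σ x W (i * δ) ω * growth μ σ q.1 q.2)) (by unfold growth; fun_prop)]

/-- The strong Markov property between consecutive event times, for bounded continuous
functions. -/
theorem strongMarkov_boundedContinuous (h : IsRegularPair F P lam W N) (hlam : 0 < lam)
    (μ σ x : ℝ) {β : ℝ} (hβ : 0 ≤ β) (n : ℕ) {A : Set Ω} (hA : IsPastEvent F (arrival N n) A)
    (f : BoundedContinuousFunction ℝ ℝ≥0) :
    ∫⁻ ω in A, discount β (arrival N (n + 1) ω) *
        f (expBM μ σ x W (arrival N (n + 1) ω) ω) ∂P =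
    ∫⁻ ω in A, ∫⁻ p : ℝ≥0 × ℝ, discount β (arrival N n ω + p.1) *
        f (expBM μ σ x W (arrival N n ω) ω * growth μ σ p.1 (√(p.1 : ℝ) * p.2))
        ∂((waitingLaw lam).prod (gaussianReal 0 1)) ∂P := by
  have := h.isProbability
  have := isProbabilityMeasure_waitingLaw hlam
  have hAm := measurableSet_of_isPastEvent hA
  set κ := (waitingLaw lam).prod (gaussianReal 0 1)
  set d : ℕ → ℝ≥0 := fun k => 1 / ((k : ℝ≥0) + 1) with hd
  have hdpos : ∀ k, 0 < d k := fun k => by positivity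
  have hf : Measurable fun y => (f y : ℝ≥0∞) := f.continuous.measurable.coe_nnreal_ennreal
  have hfc : Continuous fun y => (f y : ℝ≥0∞) := ENNReal.continuous_coe.comp f.continuous
  have hT := h.measurable_arrival n
  have hT' := h.measurable_arrival (n + 1)
  set S : ℕ → Set Ω := fun k => {ω | meshCeil (d k) (arrival N n ω) < arrival N (n + 1) ω} with hS
  have hSm : ∀ k, MeasurableSet (S k) := fun k =>
    measurableSet_lt ((measurable_meshCeil _).comp hT) hT'
  -- Arrivals are strictly increasing, so for a fine enough mesh the rounded arrival precedes the
  -- next one and the restriction to `S k` disappears in the limit.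
  have hev : ∀ ω, ∀ᶠ k in atTop, ω ∈ S k := fun ω =>
    (tendsto_meshCeil (arrival N n ω)).eventually_lt_const (h.arrival_lt n ω)
  have hgrowth : ∀ z, Continuous fun r : ℝ≥0 => growth μ σ r (√(r : ℝ) * z) := by
    intro z; unfold growth; fun_prop
  have bound : ∀ (t : ℝ≥0) (y : ℝ), discount β t * f y ≤ (nndist f 0 : ℝ≥0∞) := by
    intro t y
    calc discount β t * f y ≤ 1 * (nndist f 0 : ℝ≥0∞) := by
          gcongr
          · exact discount_le_one hβ t
          · exact BoundedContinuousFunction.NNReal.upper_bound f y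
      _ = _ := one_mul _
  have L : Tendsto (fun k => ∫⁻ ω in A ∩ S k, discount β (meshCeil (d k) (arrival N (n + 1) ω)) *
        f (expBM μ σ x W (meshCeil (d k) (arrival N (n + 1) ω)) ω) ∂P) atTop
      (𝓝 (∫⁻ ω in A, discount β (arrival N (n + 1) ω) *
        f (expBM μ σ x W (arrival N (n + 1) ω) ω) ∂P)) := by
    simp_rw [inter_comm A, ← setLIntegral_indicator (hSm _)]
    refine tendsto_lintegral_of_dominated_convergence (fun _ => (nndist f 0 : ℝ≥0∞)) ?_ ?_ ?_ ?_
    · intro k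
      have hm := (measurable_meshCeil (d k)).comp hT'
      have := h.measurable_expBM μ σ x hm
      refine Measurable.indicator ?_ (hSm k)
      exact ((measurable_discount β).comp hm).mul (hf.comp this)
    · intro k
      exact ae_of_all _ fun ω => (indicator_le_self _ _ ω).trans (bound _ _)
    · simp [ENNReal.mul_eq_top]
    · refine ae_of_all _ fun ω => ?_
      have h1 := tendsto_meshCeil (arrival N (n + 1) ω)
      refine Tendsto.congr' (f₁ := fun k => discount β (meshCeil (d k) (arrival N (n + 1) ω)) *
        f (expBM μ σ x W (meshCeil (d k) (arrival N (n + 1) ω)) ω)) ?_ ?_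
      · filter_upwards [hev ω] with k hk
        rw [indicator_of_mem hk]
      refine ENNReal.Tendsto.mul (((continuous_discount β).tendsto _).comp h1)
        (Or.inr ENNReal.coe_ne_top)
        ((hfc.tendsto _).comp (((h.continuous_expBM μ σ x ω).tendsto _).comp h1))
        (Or.inr ((discount_le_one hβ _).trans_lt ENNReal.one_lt_top).ne)
  have R : Tendsto (fun k => ∫⁻ ω in A ∩ S k, ∫⁻ p : ℝ≥0 × ℝ,
        discount β (meshCeil (d k) (arrival N n ω) + meshCeil (d k) p.1) *
        f (expBM μ σ x W (meshCeil (d k) (arrival N n ω)) ω *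
          growth μ σ (meshCeil (d k) p.1) (√(meshCeil (d k) p.1 : ℝ) * p.2)) ∂κ ∂P) atTop
      (𝓝 (∫⁻ ω in A, ∫⁻ p : ℝ≥0 × ℝ, discount β (arrival N n ω + p.1) *
        f (expBM μ σ x W (arrival N n ω) ω * growth μ σ p.1 (√(p.1 : ℝ) * p.2)) ∂κ ∂P)) := by
    simp_rw [inter_comm A, ← setLIntegral_indicator (hSm _)]
    refine tendsto_lintegral_of_dominated_convergence (fun _ => (nndist f 0 : ℝ≥0∞)) ?_ ?_ ?_ ?_
    · intro k
      have hm := (measurable_meshCeil (d k)).comp hT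
      have hc := measurable_meshCeil (d k)
      have hX := h.measurable_expBM μ σ x hm
      refine Measurable.indicator ?_ (hSm k)
      refine Measurable.lintegral_prod_right' (f := fun q : Ω × (ℝ≥0 × ℝ) =>
        discount β (meshCeil (d k) (arrival N n q.1) + meshCeil (d k) q.2.1) *
        f (expBM μ σ x W (meshCeil (d k) (arrival N n q.1)) q.1 *
          growth μ σ (meshCeil (d k) q.2.1) (√(meshCeil (d k) q.2.1 : ℝ) * q.2.2))) ?_
      refine ((measurable_discount β).comp ?_).mul (hf.comp ?_)
      · exact (hm.comp measurable_fst).add (hc.comp (measurable_fst.comp measurable_snd))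
      · refine (hX.comp measurable_fst).mul ?_
        unfold growth; fun_prop
    · intro k
      refine ae_of_all _ fun ω => (indicator_le_self _ _ ω).trans ?_
      exact (lintegral_mono fun p => bound _ _).trans (by simp)
    · simp [ENNReal.mul_eq_top]
    · refine ae_of_all _ fun ω => ?_
      have h1 := tendsto_meshCeil (arrival N n ω)
      refine Tendsto.congr' (f₁ := fun k => ∫⁻ p : ℝ≥0 × ℝ,
        discount β (meshCeil (d k) (arrival N n ω) + meshCeil (d k) p.1) *
        f (expBM μ σ x W (meshCeil (d k) (arrival N n ω)) ω *
          growth μ σ (meshCeil (d k) p.1) (√(meshCeil (d k) p.1 : ℝ) * p.2)) ∂κ) ?_ ?_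
      · filter_upwards [hev ω] with k hk
        rw [indicator_of_mem hk]
      refine tendsto_lintegral_of_dominated_convergence (fun _ => (nndist f 0 : ℝ≥0∞)) ?_ ?_ ?_ ?_
      · intro k
        have hc := measurable_meshCeil (d k)
        unfold growth
        fun_prop
      · exact fun k => ae_of_all _ fun p => bound _ _
      · simp
      · refine ae_of_all _ fun p => ?_
        have h2 := tendsto_meshCeil p.1
        have h3 : Tendsto (fun k => growth μ σ (meshCeil (d k) p.1)
            (√(meshCeil (d k) p.1 : ℝ) * p.2)) atTop (𝓝 (growth μ σ p.1 (√(p.1 : ℝ) * p.2))) :=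
          ((hgrowth p.2).tendsto p.1).comp h2
        have h4 : Tendsto (fun k => expBM μ σ x W (meshCeil (d k) (arrival N n ω)) ω) atTop
            (𝓝 (expBM μ σ x W (arrival N n ω) ω)) :=
          ((h.continuous_expBM μ σ x ω).tendsto _).comp h1
        have h5 := (hfc.tendsto _).comp (h4.mul h3)
        have h6 := ((continuous_discount β).tendsto _).comp (h1.add h2)
        exact ENNReal.Tendsto.mul h6 (Or.inr ENNReal.coe_ne_top) h5
          (Or.inr ((discount_le_one hβ _).trans_lt ENNReal.one_lt_top).ne)
  refine tendsto_nhds_unique L (R.congr fun k => ?_)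
  exact (h.markov_meshCeil hlam μ σ β x (hdpos k) n hA hf).symm

/-- The strong Markov property of exponential Brownian motion between consecutive event times. -/
theorem strongMarkov (h : IsRegularPair F P lam W N) (hlam : 0 < lam)
    (μ σ x : ℝ) {β : ℝ} (hβ : 0 ≤ β) (n : ℕ) {A : Set Ω} (hA : IsPastEvent F (arrival N n) A)
    {f : ℝ → ℝ≥0∞} (hf : Measurable f) :
    ∫⁻ ω in A, discount β (arrival N (n + 1) ω) *
        f (expBM μ σ x W (arrival N (n + 1) ω) ω) ∂P =
    ∫⁻ ω in A, discount β (arrival N n ω) *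
        poissonResolvent μ σ β lam f (expBM μ σ x W (arrival N n ω) ω) ∂P := by
  have := h.isProbability
  have := isProbabilityMeasure_waitingLaw hlam
  set κ := (waitingLaw lam).prod (gaussianReal 0 1) with hκ
  have hT := h.measurable_arrival n
  have hT' := h.measurable_arrival (n + 1)
  have hX := h.measurable_expBM μ σ x hT
  have hX' := h.measurable_expBM μ σ x hT'
  set D₁ : Ω → ℝ≥0∞ := fun ω => discount β (arrival N (n + 1) ω) with hD₁
  set D₂ : Ω × (ℝ≥0 × ℝ) → ℝ≥0∞ := fun q => discount β (arrival N n q.1 + q.2.1) with hD₂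
  set Y : Ω × (ℝ≥0 × ℝ) → ℝ := fun q => expBM μ σ x W (arrival N n q.1) q.1 *
    growth μ σ q.2.1 (√(q.2.1 : ℝ) * q.2.2) with hY
  have hD₁m : Measurable D₁ := (measurable_discount β).comp hT'
  have hD₂m : Measurable D₂ := (measurable_discount β).comp
    ((hT.comp measurable_fst).add (measurable_fst.comp measurable_snd))
  have hYm : Measurable Y := by
    refine (hX.comp measurable_fst).mul ?_
    unfold growth; fun_prop
  -- Both sides become integrals of `f` against a measure on the line; these measures agree on
  -- bounded continuous functions. The discount factor makes them finite, since it is at most one.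
  set ν₁ := ((P.restrict A).withDensity D₁).map fun ω => expBM μ σ x W (arrival N (n + 1) ω) ω
  set ν₂ := (((P.restrict A).prod κ).withDensity D₂).map Y
  have e₁ : ∀ f : ℝ → ℝ≥0∞, Measurable f → ∫⁻ y, f y ∂ν₁ = ∫⁻ ω in A,
      discount β (arrival N (n + 1) ω) * f (expBM μ σ x W (arrival N (n + 1) ω) ω) ∂P := by
    intro f hf
    rw [lintegral_map hf hX']
    exact lintegral_withDensity_eq_lintegral_mul _ hD₁m (hf.comp hX')
  have e₂ : ∀ f : ℝ → ℝ≥0∞, Measurable f → ∫⁻ y, f y ∂ν₂ =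
      ∫⁻ ω in A, ∫⁻ p : ℝ≥0 × ℝ, discount β (arrival N n ω + p.1) *
        f (expBM μ σ x W (arrival N n ω) ω * growth μ σ p.1 (√(p.1 : ℝ) * p.2)) ∂κ ∂P := by
    intro f hf
    rw [lintegral_map hf hYm]
    exact (lintegral_withDensity_eq_lintegral_mul _ hD₂m (hf.comp hYm)).trans
      (lintegral_prod _ (hD₂m.mul (hf.comp hYm)).aemeasurable)
  have hfin : IsFiniteMeasure ν₁ := by
    have : IsFiniteMeasure ((P.restrict A).withDensity D₁) := by
      refine isFiniteMeasure_withDensity ?_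
      refine ((lintegral_mono fun ω => discount_le_one hβ _).trans_lt ?_).ne
      simp
    infer_instance
  have hν : ν₁ = ν₂ := by
    refine ext_of_forall_lintegral_eq_of_IsFiniteMeasure fun f => ?_
    have hf : Measurable fun y => (f y : ℝ≥0∞) := f.continuous.measurable.coe_nnreal_ennreal
    rw [e₁ _ hf, e₂ _ hf]
    exact h.strongMarkov_boundedContinuous hlam μ σ x hβ n hA f
  rw [← e₁ f hf, hν, e₂ f hf]
  refine lintegral_congr fun ω => ?_
  rw [poissonResolvent, ← lintegral_const_mul _ (by unfold growth; fun_prop)]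
  refine lintegral_congr fun p => ?_
  rw [discount_add, mul_assoc]

end IsRegularPair

/-! ### Stopping rules and identification of the value. -/

/-- Stop at the first of the times `T k, …, T (k + n)` at which the outcome belongs to the
corresponding set of `C`; stop at `T (k + n)` in any case. -/
noncomputable def stoppingRule {Ω : Type*} (T : ℕ → Ω → ℝ≥0) (C : ℕ → ℕ → Set Ω) :
    ℕ → ℕ → Ω → ℝ≥0
  | 0, k => T k
  | n + 1, k => fun ω => open Classical in if ω ∈ C n k then T k ω else stoppingRule T C n (k + 1) ω

namespace IsRegularPair

variable {Ω : Type*} {m : MeasurableSpace Ω} {F : Filtration ℝ≥0 m} {P : Measure Ω} {lam : ℝ≥0}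
  {W : ℝ≥0 → Ω → ℝ} {N : ℝ≥0 → Ω → ℕ}

/-- Continuous adapted paths are progressively measurable, so the value at a stopping time belongs
to its past. -/
theorem isPastEvent_preimage_expBM (h : IsRegularPair F P lam W N) (μ σ x : ℝ) (n : ℕ)
    {B : Set ℝ} (hB : MeasurableSet B) :
    IsPastEvent F (arrival N n) ((fun ω => expBM μ σ x W (arrival N n ω) ω) ⁻¹' B) := by
  intro t
  have hadapt : StronglyAdapted F (expBM μ σ x W) := by
    intro s
    have hφ : Measurable fun w : ℝ => x * Real.exp (σ * w + (μ - σ ^ 2 / 2) * (s : ℝ)) := by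
      fun_prop
    exact (hφ.comp (h.adaptedW s)).stronglyMeasurable
  have hprog := hadapt.isStronglyProgressive_of_continuous (h.continuous_expBM μ σ x)
  have := measurableSet_preimage_stoppedValue_inter hprog (h.isStoppingTime_arrival n) hB t
  simp only [WithTop.coe_le_coe] at this
  exact this

theorem isPastEvent_arrival_lt (h : IsRegularPair F P lam W N) {τ : Ω → ℝ≥0}
    (hτ : IsStoppingTime F fun ω => (τ ω : WithTop ℝ≥0)) (n : ℕ) :
    IsPastEvent F (arrival N n) {ω | arrival N n ω < τ ω} := by
  have h1 : IsPastEvent F (arrival N n) {ω | τ ω ≤ arrival N n ω} := by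
    intro t
    have := ((IsStoppingTime.measurableSet_stopping_time_le hτ (h.isStoppingTime_arrival n))).2 t
    simp only [WithTop.coe_le_coe] at this
    exact this
  have : {ω | arrival N n ω < τ ω} = univ \ {ω | τ ω ≤ arrival N n ω} := by
    ext ω; simp
  rw [this]
  exact (h.isPastEvent_univ n).sdiff h1

theorem measurable_of_isStoppingTime {τ : Ω → ℝ≥0}
    (hτ : IsStoppingTime F fun ω => (τ ω : WithTop ℝ≥0)) : Measurable τ := by
  refine measurable_of_Iic fun t => F.le t _ ?_
  have := hτ t
  simp only [WithTop.coe_le_coe] at this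
  exact this

/-- The strong Markov property started from the zeroth arrival, which is time `0`. -/
theorem lintegral_discount_firstArrival (h : IsRegularPair F P lam W N) (hlam : 0 < lam)
    (μ σ x : ℝ) {β : ℝ} (hβ : 0 ≤ β) {f : ℝ → ℝ≥0∞} (hf : Measurable f) :
    ∫⁻ ω, discount β (arrival N 1 ω) * f (expBM μ σ x W (arrival N 1 ω) ω) ∂P =
      poissonResolvent μ σ β lam f x := by
  have := h.isProbability
  have key := h.strongMarkov hlam μ σ x hβ 0 (h.isPastEvent_univ 0) hf
  simp only [Measure.restrict_univ, h.arrival_zero, h.expBM_zero] at key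
  rw [key]
  simp [discount]

/-- A function which dominates `f` and its own resolvent bounds the expected discounted value of
`f` at stopping times among the event times. -/
theorem lintegral_discount_le (h : IsRegularPair F P lam W N) (hlam : 0 < lam)
    (μ σ x : ℝ) {β : ℝ} (hβ : 0 ≤ β) {f u : ℝ → ℝ≥0∞} (hu : Measurable u)
    (hfu : f ≤ u) (hru : poissonResolvent μ σ β lam u ≤ u) {τ : Ω → ℝ≥0}
    (hτ : IsStoppingTime F fun ω => (τ ω : WithTop ℝ≥0)) (hτN : ∀ᵐ ω ∂P, τ ω ∈ eventTimes N ω) :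
    ∫⁻ ω, discount β (τ ω) * f (expBM μ σ x W (τ ω) ω) ∂P ≤ poissonResolvent μ σ β lam u x := by
  have := h.isProbability
  have hτm := measurable_of_isStoppingTime hτ
  set X := expBM μ σ x W
  set T := arrival N with hTdef
  have hT : ∀ n, Measurable (T n) := h.measurable_arrival
  have hE : ∀ n, MeasurableSet {ω | τ ω = T n ω} := fun n => measurableSet_eq_fun hτm (hT n)
  have hX : ∀ n, Measurable fun ω => X (T n ω) ω := fun n => h.measurable_expBM μ σ x (hT n)
  have hR := measurable_poissonResolvent μ σ β hlam hu
  -- What has been collected up to the `n`-th event plus the continuation value where `τ` is still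
  -- to come. This total does not increase with `n`: at the next event `f ≤ u` is used where `τ`
  -- stops and `R u ≤ u` where it goes on.
  have step : ∀ n, (∑ k ∈ Finset.range n, ∫⁻ ω in {ω | τ ω = T (k + 1) ω},
        discount β (T (k + 1) ω) * f (X (T (k + 1) ω) ω) ∂P) +
      ∫⁻ ω in {ω | T n ω < τ ω},
        discount β (T n ω) * poissonResolvent μ σ β lam u (X (T n ω) ω) ∂P ≤
      poissonResolvent μ σ β lam u x := by
    intro n
    induction n with
    | zero =>
      rw [Finset.sum_range_zero, zero_add]
      refine (setLIntegral_le_lintegral _ _).trans ?_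
      simp [hTdef, h.arrival_zero, X, h.expBM_zero, discount]
    | succ n ih =>
      refine le_trans ?_ ih
      rw [Finset.sum_range_succ, add_assoc]
      gcongr
      rw [← h.strongMarkov hlam μ σ x hβ n (h.isPastEvent_arrival_lt hτ n) hu]
      have hdisj : Disjoint {ω | τ ω = T (n + 1) ω} {ω | T (n + 1) ω < τ ω} :=
        Set.disjoint_left.2 fun ω h1 h2 => by
          simp only [mem_ofPred_eq] at h1 h2
          exact h2.ne' h1
      calc _ ≤ ∫⁻ ω in {ω | τ ω = T (n + 1) ω}, discount β (T (n + 1) ω) *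
              u (X (T (n + 1) ω) ω) ∂P +
            ∫⁻ ω in {ω | T (n + 1) ω < τ ω}, discount β (T (n + 1) ω) *
              u (X (T (n + 1) ω) ω) ∂P := by
            gcongr
            · exact hfu _
            · exact hru _
        _ = ∫⁻ ω in {ω | τ ω = T (n + 1) ω} ∪ {ω | T (n + 1) ω < τ ω},
              discount β (T (n + 1) ω) * u (X (T (n + 1) ω) ω) ∂P :=
            (lintegral_union (measurableSet_lt (hT _) hτm) hdisj).symm
        _ ≤ _ := by
            refine lintegral_mono_set ?_
            rintro ω (h1 | h1)
            · exact (h.arrival_lt n ω).trans_eq h1.symm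
            · exact (h.arrival_lt n ω).trans h1
  have hcover : (⋃ k, {ω | τ ω = T (k + 1) ω}) =ᵐ[P] univ := by
    filter_upwards [hτN] with ω hω
    obtain ⟨n, hn⟩ := (h.mem_eventTimes_iff ω _).1 hω
    exact propext ⟨fun _ => trivial, fun _ => mem_iUnion.2 ⟨n, hn⟩⟩
  have hpair : Pairwise (Function.onFun Disjoint fun k => {ω | τ ω = T (k + 1) ω}) :=
    fun i j hij => Set.disjoint_left.2 fun ω hi hj => hij (by
      simp only [mem_ofPred_eq] at hi hj
      have := (h.arrival_strictMono ω).injective (hi.symm.trans hj)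
      omega)
  rw [← setLIntegral_univ, ← setLIntegral_congr hcover,
    lintegral_iUnion (fun k => hE (k + 1)) hpair]
  -- The nonnegative continuation term is dropped; no limit of it is needed.
  refine ENNReal.tsum_le_of_sum_range_le fun n => le_trans ?_ (le_self_add.trans (step n))
  refine Finset.sum_le_sum fun k _ => le_of_eq ?_
  refine setLIntegral_congr_fun (hE (k + 1)) fun ω hω => ?_
  have : τ ω = T (k + 1) ω := hω
  rw [this]

theorem stoppingRule_mem (T : ℕ → Ω → ℝ≥0) (C : ℕ → ℕ → Set Ω) (n k : ℕ) (ω : Ω) :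
    ∃ j, k ≤ j ∧ stoppingRule T C n k ω = T j ω := by
  induction n generalizing k with
  | zero => exact ⟨k, le_rfl, rfl⟩
  | succ n ih =>
    by_cases hω : ω ∈ C n k
    · exact ⟨k, le_rfl, by simp [stoppingRule, hω]⟩
    · obtain ⟨j, hj, e⟩ := ih (k + 1)
      exact ⟨j, by omega, by simp [stoppingRule, hω, e]⟩

theorem isStoppingTime_stoppingRule (h : IsRegularPair F P lam W N) {C : ℕ → ℕ → Set Ω}
    (hC : ∀ n k, IsPastEvent F (arrival N k) (C n k)) (n k : ℕ) :
    IsStoppingTime F fun ω => (stoppingRule (arrival N) C n k ω : WithTop ℝ≥0) := by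
  induction n generalizing k with
  | zero => exact h.isStoppingTime_arrival k
  | succ n ih =>
    intro t
    have h1 := ih (k + 1) t
    simp only [WithTop.coe_le_coe] at h1 ⊢
    -- When the rule does not stop at arrival `k`, it stops later than that arrival, so the
    -- membership of `C n k` is already decided.
    have e : {ω | stoppingRule (arrival N) C (n + 1) k ω ≤ t} =
        (C n k ∩ {ω | arrival N k ω ≤ t}) ∪ (({ω | arrival N k ω ≤ t} \
          (C n k ∩ {ω | arrival N k ω ≤ t})) ∩
          {ω | stoppingRule (arrival N) C n (k + 1) ω ≤ t}) := by
      ext ω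
      obtain ⟨j, hj, e⟩ := stoppingRule_mem (arrival N) C n (k + 1) ω
      have hle : arrival N k ω ≤ stoppingRule (arrival N) C n (k + 1) ω := by
        rw [e]; exact (h.arrival_strictMono ω).monotone (by omega)
      by_cases hω : ω ∈ C n k
      · simp [stoppingRule, hω]
      · simp only [stoppingRule, mem_ofPred_eq, mem_union,
          mem_inter_iff, hω, false_and, false_or, Set.mem_sdiff, not_false_eq_true, and_true]
        exact ⟨fun h2 => ⟨hle.trans h2, h2⟩, fun h2 => h2.2⟩
    rw [e]
    exact (hC n k t).union (((h.measurableSet_arrival_le k t).diff (hC n k t)).inter h1)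

/-- Dynamic programming: on `C n k` the maximum defining `valueIter` is `f` and the rule stops; off
it the maximum is the resolvent, which the strong Markov property moves to the next arrival.
Arbitrary past events `A` keep the induction going. -/
theorem lintegral_stoppingRule (h : IsRegularPair F P lam W N) (hlam : 0 < lam)
    (μ σ x : ℝ) {β : ℝ} (hβ : 0 ≤ β) {f : ℝ → ℝ≥0∞} (hf : Measurable f) {C : ℕ → ℕ → Set Ω}
    (hC : ∀ n k, C n k = {ω | poissonResolvent μ σ β lam (valueIter μ σ β lam f n)
      (expBM μ σ x W (arrival N k ω) ω) ≤ f (expBM μ σ x W (arrival N k ω) ω)})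
    (hCp : ∀ n k, IsPastEvent F (arrival N k) (C n k))
    (n k : ℕ) {A : Set Ω} (hA : IsPastEvent F (arrival N k) A) :
    ∫⁻ ω in A, discount β (stoppingRule (arrival N) C n k ω) *
        f (expBM μ σ x W (stoppingRule (arrival N) C n k ω) ω) ∂P =
      ∫⁻ ω in A, discount β (arrival N k ω) *
        valueIter μ σ β lam f n (expBM μ σ x W (arrival N k ω) ω) ∂P := by
  induction n generalizing k A with
  | zero => rfl
  | succ n ih =>
    have hAm := measurableSet_of_isPastEvent hA
    have hCm := measurableSet_of_isPastEvent (hCp n k)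
    rw [← lintegral_inter_add_sdiff (μ := P) _ A hCm,
      ← lintegral_inter_add_sdiff (μ := P) _ A hCm]
    congr 1
    · refine setLIntegral_congr_fun (hAm.inter hCm) fun ω hω => ?_
      have h1 := hω.2
      rw [hC] at h1
      simp only [stoppingRule, if_pos hω.2, valueIter]
      rw [max_eq_left h1]
    · have hd := hA.sdiff (hCp n k)
      have key := ih (k + 1) (h.isPastEvent_succ hd)
      rw [h.strongMarkov hlam μ σ x hβ k hd (measurable_valueIter μ σ β hlam hf n)] at key
      refine Eq.trans ?_ (key.trans ?_)
      · refine setLIntegral_congr_fun (hAm.diff hCm) fun ω hω => ?_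
        simp only [stoppingRule, if_neg hω.2]
      · refine setLIntegral_congr_fun (hAm.diff hCm) fun ω hω => ?_
        have h1 := hω.2
        rw [hC, mem_ofPred_eq, not_le] at h1
        simp only [valueIter]
        rw [max_eq_right h1.le]

/-- The process is positive, so `g` is evaluated only where it agrees with its extension by zero. -/
theorem expectedPayoff_eq (P : Measure Ω) (W : ℝ≥0 → Ω → ℝ) (μ σ β : ℝ) {x : ℝ} (hx : 0 < x)
    (g : ℝ → ℝ) (τ : Ω → ℝ≥0) :
    expectedPayoff P (expBM μ σ x W) β g τ =
      ∫⁻ ω, discount β (τ ω) * payoff g (expBM μ σ x W (τ ω) ω) ∂P := by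
  refine lintegral_congr fun ω => ?_
  rw [payoff_of_pos g (x := expBM μ σ x W (τ ω) ω) (mul_pos hx (Real.exp_pos _)), discount,
    ← ENNReal.ofReal_mul (Real.exp_pos _).le]

theorem poissonValue_eq (h : IsRegularPair F P lam W N) (hlam : 0 < lam)
    (μ σ : ℝ) {β x : ℝ} (hβ : 0 ≤ β) (hx : 0 < x) {g : ℝ → ℝ} (hg : Measurable (payoff g)) :
    poissonValue F P N (expBM μ σ x W) β g =
      ⨆ n, poissonResolvent μ σ β lam (valueIter μ σ β lam (payoff g) n) x := by
  have hv := measurable_valueIter μ σ β hlam hg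
  have hmono := monotone_valueIter μ σ β lam (payoff g)
  refine le_antisymm (iSup₂_le fun τ hτ => ?_) (iSup_le fun n => ?_)
  · rw [expectedPayoff_eq P W μ σ β hx, ← poissonResolvent_iSup μ σ β lam hv hmono]
    refine h.lintegral_discount_le hlam μ σ x hβ (Measurable.iSup hv) ?_ ?_ hτ.1 hτ.2
    · exact fun y => le_iSup (fun n => valueIter μ σ β lam (payoff g) n y) 0
    · intro y
      rw [poissonResolvent_iSup μ σ β lam hv hmono]
      exact iSup_le fun n => (le_max_right _ _).trans
        (le_iSup (fun n => valueIter μ σ β lam (payoff g) n y) (n + 1))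
  · set C : ℕ → ℕ → Set Ω := fun n k => {ω | poissonResolvent μ σ β lam
      (valueIter μ σ β lam (payoff g) n) (expBM μ σ x W (arrival N k ω) ω) ≤
        payoff g (expBM μ σ x W (arrival N k ω) ω)} with hC
    have hCp : ∀ n k, IsPastEvent F (arrival N k) (C n k) := fun n k =>
      h.isPastEvent_preimage_expBM μ σ x k
        (measurableSet_le (measurable_poissonResolvent μ σ β hlam (hv n)) hg)
    -- The rule starts at arrival `1` because time `0` is not an event time; this is the source of
    -- the outer resolvent.
    have key := h.lintegral_stoppingRule hlam μ σ x hβ hg (C := C) (fun _ _ => rfl) hCp n 1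
      (h.isPastEvent_univ 1)
    rw [Measure.restrict_univ, h.lintegral_discount_firstArrival hlam μ σ x hβ (hv n),
      ← expectedPayoff_eq P W μ σ β hx] at key
    rw [← key]
    refine le_iSup₂_of_le (stoppingRule (arrival N) C n 1)
      ⟨h.isStoppingTime_stoppingRule hCp n 1, ae_of_all _ fun ω => ?_⟩ le_rfl
    obtain ⟨j, hj, e⟩ := stoppingRule_mem (arrival N) C n 1 ω
    rw [e, h.mem_eventTimes_iff]
    exact ⟨j - 1, by rw [Nat.sub_add_cancel hj]⟩

end IsRegularPair

/-! ### A Poisson process almost surely visits every level. -/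

/-- The mass is `1 - (1 + r) exp (-r)`, and `exp (-r) ≥ 1 - r` gives `(1 + r) exp (-r) ≥ 1 - r ^ 2`.
-/
theorem poissonMeasure_two_le (r : ℝ≥0) :
    poissonMeasure r {k | 2 ≤ k} ≤ ENNReal.ofReal ((r : ℝ) ^ 2) := by
  have hc : {k : ℕ | 2 ≤ k} = ((Finset.range 2 : Finset ℕ) : Set ℕ)ᶜ := by
    ext k; simp
  rw [hc, prob_compl_eq_one_sub (Finset.measurableSet _), ← sum_measure_singleton,
    Finset.sum_range_succ, Finset.sum_range_one, poissonMeasure_singleton,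
    poissonMeasure_singleton, tsub_le_iff_right,
    ← ENNReal.ofReal_add (by positivity) (by positivity),
    ← ENNReal.ofReal_add (by positivity) (by positivity), ENNReal.one_le_ofReal]
  simp only [pow_zero, mul_one, Nat.factorial_zero, Nat.cast_one, div_one, pow_one,
    Nat.factorial_one]
  have h1 := Real.add_one_le_exp (-(r : ℝ))
  have h2 := mul_le_mul_of_nonneg_right h1 (by positivity : (0 : ℝ) ≤ 1 + r)
  nlinarith

theorem tendsto_poissonMeasure_lt {lam : ℝ≥0} (hlam : 0 < lam) (n : ℕ) :
    Tendsto (fun M : ℕ => poissonMeasure (lam * M) {k | k < n}) atTop (𝓝 0) := by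
  have hc : {k : ℕ | k < n} = ((Finset.range n : Finset ℕ) : Set ℕ) := by
    ext k; simp
  simp_rw [hc, ← sum_measure_singleton, poissonMeasure_singleton]
  rw [← Finset.sum_const_zero (s := Finset.range n)]
  refine tendsto_finsetSum _ fun k _ => ?_
  rw [← ENNReal.ofReal_zero]
  refine (ENNReal.continuous_ofReal.tendsto 0).comp ?_
  have h1 : Tendsto (fun M : ℕ => ((lam * (M : ℝ≥0) : ℝ≥0) : ℝ)) atTop atTop := by
    push_cast
    exact tendsto_natCast_atTop_atTop.const_mul_atTop (by exact_mod_cast hlam)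
  have h2 := (Real.tendsto_pow_mul_exp_neg_atTop_nhds_zero k).comp h1
  have h3 := h2.div_const (k.factorial : ℝ)
  rw [zero_div] at h3
  refine h3.congr fun M => ?_
  simp only [Function.comp_apply]
  ring

theorem exists_eq_of_succ_le_add_one {a : ℕ → ℕ} (h0 : a 0 = 0) {K n : ℕ}
    (hstep : ∀ j < K, a (j + 1) ≤ a j + 1) (hK : n ≤ a K) : ∃ j, a j = n := by
  induction K with
  | zero => exact ⟨0, by omega⟩
  | succ K ih =>
    by_cases h : n ≤ a K
    · exact ih (fun j hj => hstep j (by omega)) h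
    · have := hstep K (by omega)
      exact ⟨K + 1, by omega⟩

namespace IsPoissonProcess

variable {Ω : Type*} {m : MeasurableSpace Ω} {P : Measure Ω} {lam : ℝ≥0} {N : ℝ≥0 → Ω → ℕ}

/-- Unit jumps are not part of the definition and must be derived. A path that skips `n` either is
still below `n` at time `M` or rises by at least two over one of `K + 1` equal pieces of `[0, M]`.
Each piece contributes at most the square of its mean, so the second bound vanishes as `K → ∞`; the
first vanishes as `M → ∞`. -/
theorem measure_forall_ne_le (h : IsPoissonProcess lam N P) (n M K : ℕ) :
    P {ω | ∀ t, N t ω ≠ n} ≤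
      poissonMeasure (lam * M) {k | k < n} + ENNReal.ofReal ((lam * M) ^ 2 / (K + 1)) := by
  set s : ℕ → ℝ≥0 := fun j => j * ((M : ℝ≥0) / (K + 1)) with hs
  have hs0 : s 0 = 0 := by simp [hs]
  have hsK : s (K + 1) = M := by simp only [hs]; push_cast; field_simp
  have hsm : ∀ j, s j ≤ s (j + 1) := fun j => by
    simp only [hs]; gcongr; omega
  have hsub : ∀ j, s (j + 1) - s j = (M : ℝ≥0) / (K + 1) := fun j => by
    rw [tsub_eq_iff_eq_add_of_le (hsm j)]; simp only [hs]; push_cast; ring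
  have h1 : {ω | ∀ t, N t ω ≠ n} ≤ᵐ[P] ({ω | N M ω - N 0 ω < n} ∪
      ⋃ j ∈ Finset.range (K + 1), {ω | 2 ≤ N (s (j + 1)) ω - N (s j) ω} : Set Ω) := by
    filter_upwards [h.start] with ω h0 hω
    by_contra hcon
    have hcon' : ¬ (N M ω - N 0 ω < n ∨ ∃ j < K + 1, 2 ≤ N (s (j + 1)) ω - N (s j) ω) := by
      intro h'
      apply hcon
      rcases h' with h' | ⟨j, hj, h'⟩
      · exact Or.inl h'
      · exact Or.inr (mem_iUnion₂.2 ⟨j, Finset.mem_range.2 hj, h'⟩)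
    push Not at hcon'
    obtain ⟨j, hj⟩ := exists_eq_of_succ_le_add_one (a := fun j => N (s j) ω) (K := K + 1) (n := n)
      (by simp only [hs0, h0]) (fun j hj => by have := hcon'.2 j hj; omega)
      (by simp only [hsK]; omega)
    exact hω (s j) hj
  refine (measure_mono_ae h1).trans ((measure_union_le _ _).trans ?_)
  gcongr ?_ + ?_
  · have := (h.law 0 M (zero_le)).measure_eq (p := fun k => k < n) MeasurableSet.of_discrete
    rw [this, tsub_zero]
  · refine (measure_biUnion_finset_le _ _).trans ?_
    refine (Finset.sum_le_sum (g := fun _ => ENNReal.ofReal ((lam * (M / (K + 1))) ^ 2))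
      fun j _ => ?_).trans ?_
    · have := (h.law (s j) (s (j + 1)) (hsm j)).measure_eq (p := fun k => 2 ≤ k)
        MeasurableSet.of_discrete
      rw [this, hsub]
      refine (poissonMeasure_two_le _).trans_eq ?_
      push_cast; rfl
    · rw [Finset.sum_const, Finset.card_range, ← ENNReal.ofReal_nsmul]
      refine ENNReal.ofReal_le_ofReal (le_of_eq ?_)
      rw [nsmul_eq_mul]; push_cast; field_simp

theorem ae_exists_eq (h : IsPoissonProcess lam N P) (hlam : 0 < lam) (n : ℕ) :
    ∀ᵐ ω ∂P, ∃ t, N t ω = n := by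
  rw [ae_iff]
  push Not
  refine nonpos_iff_eq_zero.1 (ge_of_tendsto' (tendsto_poissonMeasure_lt hlam n) fun M => ?_)
  have hlim : Tendsto (fun K : ℕ => poissonMeasure (lam * M) {k | k < n} +
      ENNReal.ofReal ((lam * M) ^ 2 / ((K : ℝ) + 1))) atTop
      (𝓝 (poissonMeasure (lam * M) {k | k < n} + ENNReal.ofReal 0)) := by
    refine tendsto_const_nhds.add ((ENNReal.continuous_ofReal.tendsto 0).comp ?_)
    have := (tendsto_one_div_add_atTop_nhds_zero_nat (𝕜 := ℝ)).const_mul (((lam : ℝ) * M) ^ 2)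
    simpa [div_eq_mul_inv] using this
  rw [ENNReal.ofReal_zero, add_zero] at hlim
  exact ge_of_tendsto' hlim fun K => h.measure_forall_ne_le n M K

/-- By monotonicity, no event up to `v` implies none up to `u`, so the probability is a difference
of two zero-count probabilities. -/
theorem measure_sub_eq_zero_and_pos (h : IsPoissonProcess lam N P) [IsProbabilityMeasure P]
    (hlam : 0 < lam) (s : ℝ≥0) {u v : ℝ≥0} (huv : u ≤ v) :
    P {ω | N (s + u) ω - N s ω = 0 ∧ 0 < N (s + v) ω - N s ω} = waitingLaw lam (Ioc u v) := by
  have hlaw : ∀ w, P {ω | N (s + w) ω - N s ω = 0} = ENNReal.ofReal (Real.exp (-(lam * w))) := by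
    intro w
    have := (h.law s (s + w) le_self_add).measure_eq (p := fun k => k = 0)
      MeasurableSet.of_discrete
    rw [this, add_tsub_cancel_left]
    change poissonMeasure _ {0} = _
    rw [poissonMeasure_singleton]
    simp
  have hnull : NullMeasurableSet {ω | N (s + v) ω - N s ω = 0} P :=
    (h.law s (s + v) le_self_add).aemeasurable.nullMeasurable (measurableSet_singleton 0)
  have key := measure_inter_add_sdiff₀ (μ := P) {ω | N (s + u) ω - N s ω = 0} hnull
  have e1 : ({ω | N (s + u) ω - N s ω = 0} ∩ {ω | N (s + v) ω - N s ω = 0} : Set Ω) =ᵐ[P]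
      {ω | N (s + v) ω - N s ω = 0} := by
    filter_upwards [h.monotone] with ω hω
    have h1 : N (s + u) ω ≤ N (s + v) ω := hω (by gcongr)
    refine propext ⟨fun h => h.2, fun h => ⟨?_, h⟩⟩
    change N (s + v) ω - N s ω = 0 at h
    change N (s + u) ω - N s ω = 0
    omega
  have e2 : ({ω | N (s + u) ω - N s ω = 0} \ {ω | N (s + v) ω - N s ω = 0} : Set Ω) =
      {ω | N (s + u) ω - N s ω = 0 ∧ 0 < N (s + v) ω - N s ω} := by
    ext ω
    simp only [Set.mem_sdiff, mem_ofPred_eq, Nat.pos_iff_ne_zero, ne_eq]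
  rw [measure_congr e1, e2, hlaw, hlaw] at key
  rw [waitingLaw_Ioc hlam huv, ← key, ENNReal.add_sub_cancel_left ENNReal.ofReal_ne_top]

end IsPoissonProcess

/-! ### The simple Markov property and the passage to regular paths. -/

namespace IsBrownianPoissonPair

variable {Ω : Type*} {m : MeasurableSpace Ω} {F : Filtration ℝ≥0 m} {P : Measure Ω} {lam : ℝ≥0}
  {W : ℝ≥0 → Ω → ℝ} {N : ℝ≥0 → Ω → ℕ}

/-- Past data, the Brownian increment and the Poisson increments are jointly independent: the past
is independent of the pair of increments, and these are independent of each other. The integral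
factors accordingly. -/
theorem markov (h : IsBrownianPoissonPair F P lam W N) (hlam : 0 < lam) {s u v : ℝ≥0}
    (huv : u ≤ v) {B : Set Ω} (hB : MeasurableSet[F s] B) {Y : Ω → ℝ} (hY : Measurable[F s] Y)
    {φ : ℝ × ℝ → ℝ≥0∞} (hφ : Measurable φ) :
    ∫⁻ ω in B ∩ {ω | N (s + u) ω = N s ω ∧ N s ω < N (s + v) ω},
        φ (Y ω, W (s + v) ω - W s ω) ∂P =
      waitingLaw lam (Ioc u v) * ∫⁻ ω in B, ∫⁻ w, φ (Y ω, w) ∂(gaussianReal 0 v) ∂P := by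
  have := h.isProbability
  have hW : ∀ t, Measurable (W t) := fun t => (h.adaptedW t).mono (F.le t) le_rfl
  have hN : ∀ t, Measurable (N t) := fun t => (h.adaptedN t).mono (F.le t) le_rfl
  have hBm : MeasurableSet B := F.le s _ hB
  have hYm : Measurable Y := hY.mono (F.le s) le_rfl
  set Z₁ : Ω → ℝ := fun ω => W (s + v) ω - W s ω with hZ₁
  set Z₂ : Ω → ℕ × ℕ := fun ω => (N (s + u) ω - N s ω, N (s + v) ω - N s ω) with hZ₂
  -- Carrying the indicator of `B` along with `Y` lets one independence statement handle both.
  set V : Ω → ℝ × ℝ≥0∞ := fun ω => (Y ω, B.indicator 1 ω) with hV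
  have hZ₁m : Measurable Z₁ := (hW _).sub (hW _)
  have hZ₂m : Measurable Z₂ :=
    ((measurable_of_countable fun q : ℕ × ℕ => q.1 - q.2).comp ((hN _).prodMk (hN _))).prodMk
      ((measurable_of_countable fun q : ℕ × ℕ => q.1 - q.2).comp ((hN _).prodMk (hN _)))
  have hVs : Measurable[F s] V := hY.prodMk (Measurable.indicator measurable_const hB)
  have hVm : Measurable V := hVs.mono (F.le s) le_rfl
  have hind₁ : IndepFun Z₁ Z₂ P := by
    refine h.indep.comp (φ := fun w : ℝ≥0 → ℝ => w (s + v) - w s)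
      (ψ := fun c : ℝ≥0 → ℕ => (c (s + u) - c s, c (s + v) - c s)) (by fun_prop) ?_
    have hsub : ∀ w, Measurable fun c : ℝ≥0 → ℕ => c (s + w) - c s := fun w => by
      have hpair : Measurable fun c : ℝ≥0 → ℕ => (c (s + w), c s) := by fun_prop
      exact (measurable_of_countable fun q : ℕ × ℕ => q.1 - q.2).comp hpair
    exact (hsub u).prodMk (hsub v)
  have hind₂ : IndepFun V (fun ω => (Z₁ ω, Z₂ ω)) P := by
    rw [IndepFun_iff_Indep]
    refine indep_of_indep_of_le_left (indep_of_indep_of_le_right (h.indepPast s) ?_)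
      hVs.comap_le
    have hev : Measurable fun q : ℝ≥0 → ℝ × ℕ => ((q v).1, ((q u).2, (q v).2)) := by fun_prop
    rw [show (fun ω => (Z₁ ω, Z₂ ω)) = (fun q : ℝ≥0 → ℝ × ℕ => ((q v).1, ((q u).2, (q v).2))) ∘
      (fun ω (u : ℝ≥0) => (W (s + u) ω - W s ω, N (s + u) ω - N s ω)) from rfl,
      ← MeasurableSpace.comap_comp]
    exact MeasurableSpace.comap_mono hev.comap_le
  have hlawW : P.map Z₁ = gaussianReal 0 v := by
    have h1 := (h.brownian.toIsPreBrownianReal.hasLaw_sub (s + v) s).map_eq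
    have h2 : nndist ((s + v : ℝ≥0) : ℝ) (s : ℝ) = v := by
      ext
      simp
    have h3 : gaussianReal 0 (nndist (s + v).1 s.1) = gaussianReal 0 v := congrArg _ h2
    rw [h3] at h1
    exact h1
  rw [indepFun_iff_map_prod_eq_prod_map_map hVm.aemeasurable (hZ₁m.prodMk hZ₂m).aemeasurable,
    (indepFun_iff_map_prod_eq_prod_map_map hZ₁m.aemeasurable hZ₂m.aemeasurable).1 hind₁,
    hlawW] at hind₂
  have := Measure.isProbabilityMeasure_map (μ := P) hZ₂m.aemeasurable
  set D : Set (ℕ × ℕ) := {q | q.1 = 0 ∧ 0 < q.2} with hD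
  have hDm : MeasurableSet D := MeasurableSet.of_discrete
  have hPD : P.map Z₂ D = waitingLaw lam (Ioc u v) := by
    rw [Measure.map_apply hZ₂m hDm]
    exact h.poisson.measure_sub_eq_zero_and_pos hlam s huv
  set Φ : (ℝ × ℝ≥0∞) × (ℝ × (ℕ × ℕ)) → ℝ≥0∞ :=
    fun q => q.1.2 * (φ (q.1.1, q.2.1) * D.indicator 1 q.2.2) with hΦ
  have hΦm : Measurable Φ := by
    have h1 : Measurable (D.indicator (1 : ℕ × ℕ → ℝ≥0∞)) := measurable_one.indicator hDm
    fun_prop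
  have hEm : MeasurableSet {ω | N (s + u) ω = N s ω ∧ N s ω < N (s + v) ω} :=
    (measurableSet_eq_fun (hN _) (hN _)).inter (measurableSet_lt (hN _) (hN _))
  calc _ = ∫⁻ ω, Φ (V ω, (Z₁ ω, Z₂ ω)) ∂P := by
        rw [← lintegral_indicator (hBm.inter hEm)]
        refine lintegral_congr_ae ?_
        filter_upwards [h.poisson.monotone] with ω hω
        have h1 : N s ω ≤ N (s + u) ω := hω le_self_add
        have hiff : (N (s + u) ω = N s ω ∧ N s ω < N (s + v) ω) ↔ Z₂ ω ∈ D := by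
          simp only [hD, hZ₂, mem_ofPred_eq]; omega
        by_cases hb : ω ∈ B <;> by_cases hd : Z₂ ω ∈ D <;>
          simp [hΦ, hV, hb, hd, hiff, indicator, hZ₁]
    _ = ∫⁻ q, Φ q ∂((P.map V).prod ((gaussianReal 0 v).prod (P.map Z₂))) := by
        rw [← hind₂, lintegral_map hΦm (hVm.prodMk (hZ₁m.prodMk hZ₂m))]
    _ = ∫⁻ a, a.2 * ((∫⁻ w, φ (a.1, w) ∂(gaussianReal 0 v)) * waitingLaw lam (Ioc u v))
          ∂(P.map V) := by
        rw [lintegral_prod _ hΦm.aemeasurable]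
        refine lintegral_congr fun a => ?_
        have h1 : Measurable (D.indicator (1 : ℕ × ℕ → ℝ≥0∞)) := measurable_one.indicator hDm
        simp only [hΦ]
        rw [lintegral_const_mul _ (by fun_prop),
          lintegral_prod_mul (f := fun w => φ (a.1, w)) (g := D.indicator 1)
            (by fun_prop) h1.aemeasurable, lintegral_indicator_one hDm, hPD]
    _ = ∫⁻ ω, B.indicator 1 ω * ((∫⁻ w, φ (Y ω, w) ∂(gaussianReal 0 v)) *
          waitingLaw lam (Ioc u v)) ∂P := by
        rw [lintegral_map _ hVm]
        have : Measurable fun y => ∫⁻ w, φ (y, w) ∂(gaussianReal 0 v) := hφ.lintegral_prod_right'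
        fun_prop
    _ = _ := by
        have h1 : Measurable fun y => ∫⁻ w, φ (y, w) ∂(gaussianReal 0 v) :=
          hφ.lintegral_prod_right'
        have h2 : Measurable fun ω => ∫⁻ w, φ (Y ω, w) ∂(gaussianReal 0 v) := h1.comp hYm
        rw [← lintegral_const_mul _ h2, ← lintegral_indicator hBm]
        refine lintegral_congr fun ω => ?_
        by_cases hb : ω ∈ B <;> simp [hb, mul_comm]

/-- A Brownian motion and an independent Poisson process are indistinguishable from a pair all
of whose paths are regular. -/
theorem exists_isRegularPair (h : IsBrownianPoissonPair F P lam W N) (hlam : 0 < lam) :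
    ∃ (W' : ℝ≥0 → Ω → ℝ) (N' : ℝ≥0 → Ω → ℕ), IsRegularPair F P lam W' N' ∧
      ∀ᵐ ω ∂P, ∀ t, W t ω = W' t ω ∧ N t ω = N' t ω := by
  classical
  set R : Ω → Prop := fun ω => W 0 ω = 0 ∧ (Continuous fun t => W t ω) ∧ N 0 ω = 0 ∧
    (Monotone fun t => N t ω) ∧ (∀ t, ContinuousWithinAt (fun s => N s ω) (Ici t) t) ∧
    ∀ n, ∃ t, N t ω = n with hR
  have hae : ∀ᵐ ω ∂P, R ω := by
    filter_upwards [h.brownian.toIsPreBrownianReal.eval_zero_ae_eq_zero, h.brownian.cont,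
      h.poisson.start, h.poisson.monotone, h.poisson.rightCont,
      ae_all_iff.2 (h.poisson.ae_exists_eq hlam)] with ω h1 h2 h3 h4 h5 h6
    exact ⟨h1, h2, h3, h4, h5, h6⟩
  have hRF : ∀ t, MeasurableSet[F t] {ω | R ω} := fun t => by
    -- Completeness enters here: the exceptional null set is known at time `0`, so altering paths on
    -- it preserves adaptedness.
    have h0 : MeasurableSet[F 0] {ω | R ω}ᶜ := h.usual.complete _ hae
    exact F.mono (zero_le) _ h0.of_compl
  -- On the exceptional set any deterministic regular path will do; `⌊t⌋₊` is right-constant and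
  -- attains every level.
  have hae' : ∀ᵐ ω ∂P, ∀ t, W t ω = (if R ω then W t ω else 0) ∧
      N t ω = if R ω then N t ω else ⌊t⌋₊ := by
    filter_upwards [hae] with ω hω t
    simp [hω]
  refine ⟨fun t ω => if R ω then W t ω else 0, fun t ω => if R ω then N t ω else ⌊t⌋₊, ?_, hae'⟩
  refine ⟨h.isProbability, fun t => ?_, fun t => ?_, fun ω => ?_, fun ω => ?_, fun ω => ?_,
    fun ω => ?_, fun ω t => ?_, fun ω n => ?_, fun s u v huv B hB Y hY φ hφ => ?_⟩
  · exact Measurable.ite (hRF t) (h.adaptedW t) measurable_const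
  · exact Measurable.ite (hRF t) (h.adaptedN t) measurable_const
  · by_cases hω : R ω
    · simpa only [hω, if_true] using hω.2.1
    · simpa only [hω, if_false] using continuous_const
  · by_cases hω : R ω
    · simpa only [hω, if_true] using hω.1
    · simp only [hω, if_false]
  · by_cases hω : R ω
    · simpa only [hω, if_true] using hω.2.2.1
    · simp only [hω, if_false, Nat.floor_zero]
  · by_cases hω : R ω
    · simpa only [hω, if_true] using hω.2.2.2.1
    · simpa only [hω, if_false] using Nat.floor_mono
  · by_cases hω : R ω
    · simp only [hω, if_true]
      have h1 : ∀ᶠ s in 𝓝[≥] t, N s ω = N t ω :=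
        (hω.2.2.2.2.1 t).eventually (p := fun y => y = N t ω)
          (by rw [nhds_discrete]; exact eventually_pure.2 rfl)
      have h2 : ∀ᶠ s in 𝓝[>] t, N s ω = N t ω := nhdsWithin_mono t Ioi_subset_Ici_self h1
      obtain ⟨s, hs, hts⟩ := (h2.and self_mem_nhdsWithin).exists
      exact ⟨s, hts, hs⟩
    · simp only [hω, if_false]
      obtain ⟨s, hts, hs⟩ := exists_between (Nat.lt_floor_add_one t)
      refine ⟨s, hts, le_antisymm ?_ (Nat.floor_mono hts.le)⟩
      rw [← Nat.lt_succ_iff, Nat.floor_lt (zero_le)]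
      exact_mod_cast hs
  · by_cases hω : R ω
    · simpa only [hω, if_true] using hω.2.2.2.2.2 n
    · exact ⟨n, by simp only [hω, if_false, Nat.floor_natCast]⟩
  · rw [← h.markov hlam huv hB hY hφ]
    have hset : (B ∩ {ω | N (s + u) ω = N s ω ∧ N s ω < N (s + v) ω} : Set Ω) =ᵐ[P]
        (B ∩ {ω | (if R ω then N (s + u) ω else ⌊s + u⌋₊) = (if R ω then N s ω else ⌊s⌋₊) ∧
          (if R ω then N s ω else ⌊s⌋₊) < if R ω then N (s + v) ω else ⌊s + v⌋₊} : Set Ω) := by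
      filter_upwards [hae] with ω hω
      refine propext (and_congr Iff.rfl ?_)
      simp [hω]
    rw [← Measure.restrict_congr_set hset]
    refine lintegral_congr_ae (ae_restrict_of_ae ?_)
    filter_upwards [hae] with ω hω
    simp only [hω, if_true]

end IsBrownianPoissonPair

/-! ### Transfer to the original pair and conclusion. -/

theorem expectedPayoff_congr_ae {Ω : Type*} {m : MeasurableSpace Ω} {P : Measure Ω}
    {W W' : ℝ≥0 → Ω → ℝ} (hW : ∀ᵐ ω ∂P, ∀ t, W t ω = W' t ω) (μ σ β x : ℝ) (g : ℝ → ℝ)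
    {τ τ' : Ω → ℝ≥0} (hτ : τ =ᵐ[P] τ') :
    expectedPayoff P (expBM μ σ x W) β g τ = expectedPayoff P (expBM μ σ x W') β g τ' := by
  refine lintegral_congr_ae ?_
  filter_upwards [hW, hτ] with ω h1 h2
  rw [h2, expBM, expBM, h1]

theorem eventTimes_congr {Ω : Type*} {N N' : ℝ≥0 → Ω → ℕ} {ω : Ω} (h : ∀ t, N t ω = N' t ω) :
    eventTimes N ω = eventTimes N' ω := by
  simp only [eventTimes, h]

theorem poissonValue_congr_ae {Ω : Type*} {m : MeasurableSpace Ω} {P : Measure Ω}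
    (F : Filtration ℝ≥0 m) {W W' : ℝ≥0 → Ω → ℝ} {N N' : ℝ≥0 → Ω → ℕ}
    (hWN : ∀ᵐ ω ∂P, ∀ t, W t ω = W' t ω ∧ N t ω = N' t ω) (μ σ β x : ℝ) (g : ℝ → ℝ) :
    poissonValue F P N (expBM μ σ x W) β g = poissonValue F P N' (expBM μ σ x W') β g := by
  have hset : poissonStoppingTimes F P N = poissonStoppingTimes F P N' := by
    ext τ
    refine and_congr Iff.rfl (eventually_congr ?_)
    filter_upwards [hWN] with ω hω
    rw [eventTimes_congr fun t => (hω t).2]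
  rw [poissonValue, poissonValue, hset]
  refine iSup_congr fun τ => iSup_congr fun _ =>
    expectedPayoff_congr_ae ?_ μ σ β x g (ae_eq_refl τ)
  filter_upwards [hWN] with ω hω t using (hω t).1

namespace IsBrownianPoissonPair

variable {Ω : Type*} {m : MeasurableSpace Ω} {F : Filtration ℝ≥0 m} {P : Measure Ω} {lam : ℝ≥0}
  {W : ℝ≥0 → Ω → ℝ} {N : ℝ≥0 → Ω → ℕ}

theorem expectedPayoff_const (h : IsBrownianPoissonPair F P lam W N) (μ σ β : ℝ) {x : ℝ}
    (hx : 0 < x) {g : ℝ → ℝ} (hg : Measurable (payoff g)) (t : ℝ≥0) :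
    expectedPayoff P (expBM μ σ x W) β g (fun _ => t) =
      ∫⁻ w, discount β t * payoff g (x * growth μ σ t w) ∂(gaussianReal 0 t) := by
  rw [IsRegularPair.expectedPayoff_eq P W μ σ β hx]
  refine (h.brownian.toIsPreBrownianReal.hasLaw_eval t).lintegral_comp
    (f := fun w => discount β t * payoff g (x * growth μ σ t w)) ?_
  unfold growth
  fun_prop

theorem expectedPayoff_firstEventTime (h : IsBrownianPoissonPair F P lam W N) (hlam : 0 < lam)
    (μ σ : ℝ) {β x : ℝ} (hβ : 0 ≤ β) (hx : 0 < x) {g : ℝ → ℝ} (hg : Measurable (payoff g)) :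
    expectedPayoff P (expBM μ σ x W) β g (firstEventTime N) =
      poissonResolvent μ σ β lam (payoff g) x := by
  obtain ⟨W', N', h', hae⟩ := h.exists_isRegularPair hlam
  rw [← h'.lintegral_discount_firstArrival hlam μ σ x hβ hg,
    ← IsRegularPair.expectedPayoff_eq P W' μ σ β hx]
  refine expectedPayoff_congr_ae ?_ μ σ β x g ?_
  · filter_upwards [hae] with ω hω t using (hω t).1
  · filter_upwards [hae] with ω hω
    rw [← h'.firstEventTime_eq, firstEventTime, firstEventTime, eventTimes_congr fun t => (hω t).2]

theorem poissonValue_eq (h : IsBrownianPoissonPair F P lam W N) (hlam : 0 < lam)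
    (μ σ : ℝ) {β x : ℝ} (hβ : 0 ≤ β) (hx : 0 < x) {g : ℝ → ℝ} (hg : Measurable (payoff g)) :
    poissonValue F P N (expBM μ σ x W) β g =
      ⨆ n, poissonResolvent μ σ β lam (valueIter μ σ β lam (payoff g) n) x := by
  obtain ⟨W', N', h', hae⟩ := h.exists_isRegularPair hlam
  rw [poissonValue_congr_ae F hae, h'.poissonValue_eq hlam μ σ hβ hx hg]

end IsBrownianPoissonPair

theorem mainTheorem12
    (μ σ β : ℝ) (hσ : 0 < σ) (hβ : 0 < β) (lam : ℝ≥0) (hlam : 0 < lam)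
    (g : ℝ → ℝ) (hg_nonneg : ∀ x, 0 < x → 0 ≤ g x) (hg : ConvexOn ℝ (Ioi 0) g)
    -- for each starting point `x > 0`, an arbitrary filtered probability space of its own
    (Ω : ℝ → Type*) (m : ∀ x, MeasurableSpace (Ω x))
    (F : ∀ x, Filtration ℝ≥0 (m x)) (P : ∀ x, Measure (Ω x))
    (W : ∀ x, ℝ≥0 → Ω x → ℝ) (N : ∀ x, ℝ≥0 → Ω x → ℕ)
    (hWN : ∀ x, 0 < x → IsBrownianPoissonPair (F x) (P x) lam (W x) (N x)) :
    (∀ t : ℝ≥0, ConvexOn ℝ≥0 (Ioi (0 : ℝ)) fun x =>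
      expectedPayoff (P x) (expBM μ σ x (W x)) β g (fun _ => t)) ∧
    (ConvexOn ℝ≥0 (Ioi (0 : ℝ)) fun x =>
      expectedPayoff (P x) (expBM μ σ x (W x)) β g (firstEventTime (N x))) ∧
    (ConvexOn ℝ≥0 (Ioi (0 : ℝ)) fun x =>
      poissonValue (F x) (P x) (N x) (expBM μ σ x (W x)) β g) := by
  have hpm := measurable_payoff hg
  have hpc := convexOn_payoff hg_nonneg hg
  refine ⟨fun t => ?_, ?_, ?_⟩
  · refine (ConvexOn.lintegral_dilation (gaussianReal 0 t) hpm hpc (d := fun _ => discount β t)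
      measurable_const (c := growth μ σ t) (by unfold growth; fun_prop)
      (growth_pos μ σ t)).congr fun x hx => ?_
    exact ((hWN x hx).expectedPayoff_const μ σ β hx hpm t).symm
  · exact (ConvexOn.poissonResolvent μ σ β lam hpm hpc).congr fun x hx =>
      ((hWN x hx).expectedPayoff_firstEventTime hlam μ σ hβ.le hx hpm).symm
  · exact (ConvexOn.iSup_ennreal fun n => ConvexOn.poissonResolvent μ σ β lam
      (measurable_valueIter μ σ β hlam hpm n) (convexOn_valueIter μ σ β hlam hpm hpc n)).congr
      fun x hx => ((hWN x hx).poissonValue_eq hlam μ σ hβ.le hx hpm).symm
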